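/- There is an algorithm for the unit-cost random access machine (a single fixed program, with addition, truncated subtraction, indirect memory access and zero tests as its operations on natural numbers) with the following property. Let $G=((S,E),(S_1,S_2))$ be a game graph: a finite directed graph $(S,E)$ with $n=|S|\ge 1$ states and $m=|E|$ edges in which every state has at least one outgoing edge, together with a partition of $S$ into player-1 states $S_1$ and player-2 states $S_2$. Let $p:S\to[d]=\{0,\dots,d-1\}$ be a priority function. Plays are infinite paths; a strategy of player $\ell$ maps every finite sequence of states that ends in a state of $S_\ell$ to a successor of that state. $\mathrm{WeakParityEven}(p)$ (resp. $\mathrm{WeakParityOdd}(p)$) is the set of plays in which the minimal priority of the states that occur is even (resp. odd), and $W_\ell(\Phi)$ is the set of states from which player $\ell$ has a strategy that ensures, against all strategies of the other player, that the resulting play is in $\Phi$. Given $n$, $m$, $d$, an array with the owner of each state, an array with the priority of each state, and a list of the edges in any order (for any numbering of the states by $0,\dots,n-1$), the algorithm outputs the characteristic arrays of $W_1(\mathrm{WeakParityEven}(p))$ and $W_2(\mathrm{WeakParityOdd}(p))$. If $d=O(n)$, it does so in $O(m)$ time: for every constant $K$ there is a constant $c$ such that the algorithm halts after at most $c\cdot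 m$ steps on every such input with $d\le K n$. -/

import Mathlib

/-- A game graph `((S, E), (S₁, S₂))` on the state space `S` in which every state has a successor.
The partition is given by the set `S₁` of player 1 states; `S₂` is its complement. -/
structure GameGraph (S : Type*) where
  E : Set (S × S)
  S₁ : Set S
  exists_succ : ∀ s : S, ∃ t : S, (s, t) ∈ E

namespace GameGraph

variable {S : Type*} (G : GameGraph S)

/-- The set of player 2 states. -/
def S₂ : Set S := G.S₁ᶜ

/-- The set `Ω` of plays: infinite paths of the graph. -/
def plays : Set (ℕ → S) := {ω | ∀ k, (ω k, ω (k + 1)) ∈ G.E}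

/-- A strategy `S* · U → S` for the player who owns the states in `U`: given a history `w` followed
by the current state `u ∈ U`, it chooses a successor of `u`. -/
structure Strategy (U : Set S) where
  move : List S → U → S
  legal : ∀ (w : List S) (u : U), ((u : S), move w u) ∈ G.E

open Classical in
/-- The history before time `k` (in chronological order) and the state at time `k`, when the game
starts in `s` and the players use `σ` and `π`. -/
noncomputable def outcome (s : S) (σ : G.Strategy G.S₁) (π : G.Strategy G.S₂) : ℕ → List S × S
  | 0 => ([], s)
  | k + 1 =>
    let w := (outcome s σ π k).1
    let u := (outcome s σ π k).2
    (w ++ [u], if h : u ∈ G.S₁ then σ.move w ⟨u, h⟩ else π.move w ⟨u, h⟩)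

/-- The unique play `ω(s, σ, π)`. -/
noncomputable def play (s : S) (σ : G.Strategy G.S₁) (π : G.Strategy G.S₂) : ℕ → S :=
  fun k => (G.outcome s σ π k).2

/-- The set of states from which player 1 has a winning strategy for the objective `Φ`. -/
def W₁ (Φ : Set (ℕ → S)) : Set S :=
  {s | ∃ σ : G.Strategy G.S₁, ∀ π : G.Strategy G.S₂, G.play s σ π ∈ Φ}

/-- The set of states from which player 2 has a winning strategy for the objective `Ψ`. -/
def W₂ (Ψ : Set (ℕ → S)) : Set S :=
  {s | ∃ π : G.Strategy G.S₂, ∀ σ : G.Strategy G.S₁, G.play s σ π ∈ Ψ}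

/-- The set of states that occur in `ω`. -/
def occur (ω : ℕ → S) : Set S := {s | ∃ k, ω k = s}

/-- The minimal priority that occurs in `ω` (a minimum of a nonempty set of natural numbers). -/
noncomputable def minPriority {d : ℕ} (p : S → Fin d) (ω : ℕ → S) : ℕ :=
  sInf ((fun s => (p s : ℕ)) '' occur ω)

def weakParityEven {d : ℕ} (p : S → Fin d) : Set (ℕ → S) :=
  {ω | ω ∈ G.plays ∧ Even (minPriority p ω)}

def weakParityOdd {d : ℕ} (p : S → Fin d) : Set (ℕ → S) :=
  {ω | ω ∈ G.plays ∧ Odd (minPriority p ω)}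

open Classical in
/-- The array of owners: entry `i` is the number (1 or 2) of the player who owns state `i`. -/
noncomputable def ownerArray {n : ℕ} (ν : S ≃ Fin n) : List ℕ :=
  (List.finRange n).map fun i => if ν.symm i ∈ G.S₁ then 1 else 2

end GameGraph

/-- The array of priorities: entry `i` is the priority of state `i`. -/
def priorityArray {S : Type*} {n d : ℕ} (ν : S ≃ Fin n) (p : S → Fin d) : List ℕ :=
  (List.finRange n).map fun i => (p (ν.symm i) : ℕ)

/-- A list of edges, each given by the numbers of its source and its target. -/
def edgeArray {S : Type*} {n : ℕ} (ν : S ≃ Fin n) (edges : List (S × S)) : List ℕ :=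
  edges.flatMap fun e => [(ν e.1 : ℕ), (ν e.2 : ℕ)]

open Classical in
/-- The characteristic array of a set of states. -/
noncomputable def setArray {S : Type*} {n : ℕ} (ν : S ≃ Fin n) (W : Set S) : List ℕ :=
  (List.finRange n).map fun i => if ν.symm i ∈ W then 1 else 0

/-- The input: the numbers of states, edges and priorities, the owner of each state, the priority of
each state, and the list of edges. -/
noncomputable def gameInput {S : Type*} {n d : ℕ} (G : GameGraph S) (p : S → Fin d)
    (ν : S ≃ Fin n) (edges : List (S × S)) : List ℕ :=
  [n, edges.length, d] ++ G.ownerArray ν ++ priorityArray ν p ++ edgeArray ν edges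

namespace RAM

/-- The instructions of a random access machine with addition and truncated subtraction. There are
registers `R`, named in the instructions, and a memory `M`, accessed through addresses held in
registers. Each instruction costs one unit of time. -/
inductive Instr where
  /-- `R[r] := k` -/
  | const (r k : ℕ)
  /-- `R[r] := R[a] + R[b]` -/
  | add (r a b : ℕ)
  /-- `R[r] := R[a] - R[b]`, or `0` if this is negative -/
  | sub (r a b : ℕ)
  /-- `R[r] := M[R[a]]` -/
  | load (r a : ℕ)
  /-- `M[R[a]] := R[r]` -/
  | store (a r : ℕ)
  /-- go to instruction `l` -/
  | jump (l : ℕ)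
  /-- go to instruction `l` if `R[r] = 0` -/
  | jumpZero (r l : ℕ)

/-- A program is a finite list of instructions; it halts on leaving the list. -/
abbrev Program := List Instr

structure Config where
  pc : ℕ
  reg : ℕ → ℕ
  mem : ℕ → ℕ

/-- The effect of one instruction. -/
def Instr.exec (C : Config) : Instr → Config
  | .const r k => ⟨C.pc + 1, Function.update C.reg r k, C.mem⟩
  | .add r a b => ⟨C.pc + 1, Function.update C.reg r (C.reg a + C.reg b), C.mem⟩
  | .sub r a b => ⟨C.pc + 1, Function.update C.reg r (C.reg a - C.reg b), C.mem⟩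
  | .load r a => ⟨C.pc + 1, Function.update C.reg r (C.mem (C.reg a)), C.mem⟩
  | .store a r => ⟨C.pc + 1, C.reg, Function.update C.mem (C.reg a) (C.reg r)⟩
  | .jump l => ⟨l, C.reg, C.mem⟩
  | .jumpZero r l => ⟨if C.reg r = 0 then l else C.pc + 1, C.reg, C.mem⟩

/-- One step of the machine; a halted configuration does not change. -/
def step (P : Program) (C : Config) : Config :=
  match P[C.pc]? with
  | some I => I.exec C
  | none => C

/-- The initial configuration: the input is in the memory from address `0` on, and everything else
is `0`. -/
def init (x : List ℕ) : Config := ⟨0, fun _ => 0, fun i => x.getD i 0⟩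

/-- On the input `x`, the program halts after at most `t` steps, and then the output `y` is in the
memory from address `0` on. -/
def ComputesWithin (P : Program) (x y : List ℕ) (t : ℕ) : Prop :=
  ∃ k ≤ t, P.length ≤ ((step P)^[k] (init x)).pc ∧
    ∀ (i : ℕ) (h : i < y.length), ((step P)^[k] (init x)).mem i = y[i]

end RAM

/-!
The winner of a weak parity game can be computed by an attractor computation in stages. Stage `j`
treats the priority `j - 1`; no state that is left has a smaller one. It gives the
stage `j` to the states of this priority and, one after the other, to all states from which the
player with the parity of `j - 1` can force the play to them. The winner of a state is determined by
the parity of its stage.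

*Why this is correct.* The winner plays as follows at the states that he owns. If the stage of the
state is one that he wins, and the priority of the state is not that of the stage, then he moves to a
state of the same stage that got its stage earlier. Otherwise he moves to a state whose stage is not
smaller than the present one, which is possible because a state without a stage always has a
successor without an earlier stage. Such a play starts in a stage that he wins, and its stage
decreases only to stages that he wins, since the opponent can leave the part of the game that a stage
started with only towards states that the winner of the play has won in an earlier stage.
Hence the least stage `j` of the play is one that he wins, and once it has been reached
the play comes closer and closer to a state of priority `j - 1`; no state of the play has a smaller
priority because the stage of a state is at most its priority plus one. The local conditions used here
are `GameGraph.JustifiedStages`, and the argument is `GameGraph.JustifiedStages.mem_W₁_iff` and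
`GameGraph.JustifiedStages.mem_W₂_iff`.

*Why it takes linear time.* The incoming edges of each state and the states of each priority are held
in linked lists, the states whose incoming edges have not been scanned wait on a stack, and for each
state without a stage the edges that have not been scanned are counted. All this is done by one
loop whose body, `WeakParity.mainStep`, is free of loops: it scans an edge, takes a state from the
stack, takes a state of the current priority, or starts the next stage, whichever is possible first.
The invariant is `ArrayGame.Inv`, and each pass decreases `ArrayGame.potential`, which is
at most `m + 2 * n + d + 1` at first. Every state has an outgoing edge, so that `n ≤ m`.

The program is written in a small structured language, `Cmd`, with named variables and arrays that
cannot overlap. `Cmd.runs_of_vc` and `Cmd.Runs.loop` reduce statements about the compiled machine code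
to weakest preconditions of loop-free commands and to loop invariants that bound the number of passes.
-/

/-! ### A structured language on top of the machine -/

/-- The scalar variables of the program. -/
inductive Var where
  | n | m | d | one | ownBase | prioBase | edgeBase | counter | index
  | stage | player | go | edge | stack | seed | u | v | x | y | z
  deriving DecidableEq

/-- The arrays of the program. -/
inductive Arr where
  | head | next | count | stageOf | seedHead | seedNext | stackNext | playerOf
  deriving DecidableEq

/-- The position of a variable among the variables. -/
def Var.idx : Var → ℕ
  | n => 0 | m => 1 | d => 2 | one => 3 | ownBase => 4 | prioBase => 5 | edgeBase => 6
  | counter => 7 | index => 8 | stage => 9 | player => 10 | go => 11 | edge => 12 | stack => 13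
  | seed => 14 | u => 15 | v => 16 | x => 17 | y => 18 | z => 19

/-- The position of an array among the arrays. -/
def Arr.idx : Arr → ℕ
  | head => 0 | next => 1 | count => 2 | stageOf => 3 | seedHead => 4 | seedNext => 5
  | stackNext => 6 | playerOf => 7

theorem Var.idx_inj {a b : Var} (h : a.idx = b.idx) : a = b := by
  revert h; cases a <;> cases b <;> simp [Var.idx]

theorem Arr.idx_inj {a b : Arr} (h : a.idx = b.idx) : a = b := by
  revert h; cases a <;> cases b <;> simp [Arr.idx]

theorem Arr.idx_lt (a : Arr) : a.idx < 8 := by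
  cases a <;> simp [Arr.idx]

/-- A store of the structured language: the variables, the input/output region, and infinitely long
arrays, which do not overlap. -/
structure Store where
  reg : Var → ℕ
  io : ℕ → ℕ
  arr : Arr → ℕ → ℕ

namespace Store

def setReg (s : Store) (r : Var) (k : ℕ) : Store := { s with reg := Function.update s.reg r k }

def setIo (s : Store) (i k : ℕ) : Store := { s with io := Function.update s.io i k }

def setArr (s : Store) (a : Arr) (i k : ℕ) : Store :=
  { s with arr := Function.update s.arr a (Function.update (s.arr a) i k) }

variable (s : Store) (r r' : Var) (a a' : Arr) (i k : ℕ)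

@[simp] theorem setReg_reg : (s.setReg r k).reg r' = if r' = r then k else s.reg r' := by
  simp [setReg, Function.update_apply]
@[simp] theorem setReg_io : (s.setReg r k).io = s.io := rfl
@[simp] theorem setReg_arr : (s.setReg r k).arr = s.arr := rfl
@[simp] theorem setIo_reg : (s.setIo i k).reg = s.reg := rfl
@[simp] theorem setIo_io : (s.setIo i k).io = Function.update s.io i k := rfl
@[simp] theorem setIo_arr : (s.setIo i k).arr = s.arr := rfl
@[simp] theorem setArr_reg : (s.setArr a i k).reg = s.reg := rfl
@[simp] theorem setArr_io : (s.setArr a i k).io = s.io := rfl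
@[simp] theorem setArr_arr : (s.setArr a i k).arr a' =
    if a' = a then Function.update (s.arr a) i k else s.arr a' := by
  simp only [setArr, Function.update_apply]

end Store

/-- Commands of the structured language. -/
inductive Cmd where
  /-- `r := k` -/
  | const (r : Var) (k : ℕ)
  /-- `r := a + b` -/
  | add (r a b : Var)
  /-- `r := a - b` -/
  | sub (r a b : Var)
  /-- `r := io[a]` -/
  | get (r a : Var)
  /-- `io[a] := r` -/
  | put (a r : Var)
  /-- `r := A[a]` -/
  | load (A : Arr) (r a : Var)
  /-- `A[a] := r` -/
  | store (A : Arr) (a r : Var)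
  | seq (c₁ c₂ : Cmd)
  /-- `c₁` if `r = 0`, and `c₂` otherwise -/
  | ifZero (r : Var) (c₁ c₂ : Cmd)
  /-- repeat `c` as long as `r ≠ 0` -/
  | loop (r : Var) (c : Cmd)

namespace Cmd

open RAM

infixr:60 " ;; " => Cmd.seq

/-- The machine register that holds a variable. The registers `0`, `1` and `2` are reserved for the
size of the input/output region and for the computation of addresses. -/
def vr (r : Var) : ℕ := r.idx + 3

/-- Puts the address of the cell `A[a]` into register `1`. The cell `i` of the array with index `k`
is at the address `L + 8 * i + k`, where `L` is the size of the input/output region. -/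
def addrCode (A : Arr) (a : Var) : Program :=
  [.add 1 (vr a) (vr a), .add 1 1 1, .add 1 1 1, .add 1 1 0, .const 2 A.idx, .add 1 1 2]

/-- The machine code of a command that starts at the address `o`. -/
def code : Cmd → ℕ → Program
  | const r k, _ => [.const (vr r) k]
  | add r a b, _ => [.add (vr r) (vr a) (vr b)]
  | sub r a b, _ => [.sub (vr r) (vr a) (vr b)]
  | get r a, _ => [.load (vr r) (vr a)]
  | put a r, _ => [.store (vr a) (vr r)]
  | load A r a, _ => addrCode A a ++ [.load (vr r) 1]
  | store A a r, _ => addrCode A a ++ [.store 1 (vr r)]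
  | seq c₁ c₂, o => c₁.code o ++ c₂.code (o + (c₁.code o).length)
  | ifZero r c₁ c₂, o =>
    .jumpZero (vr r) (o + 1 + (c₂.code (o + 1)).length + 1) ::
      (c₂.code (o + 1) ++
        .jump (o + 1 + (c₂.code (o + 1)).length + 1 +
          (c₁.code (o + 1 + (c₂.code (o + 1)).length + 1)).length) ::
        c₁.code (o + 1 + (c₂.code (o + 1)).length + 1))
  | .loop r c, o =>
    .jumpZero (vr r) (o + 1 + (c.code (o + 1)).length + 1) :: (c.code (o + 1) ++ [.jump o])

/-- The code `l` stands in the program `P` at the address `o`. -/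
def Placed (P : Program) : ℕ → Program → Prop
  | _, [] => True
  | o, I :: l => P[o]? = some I ∧ Placed P (o + 1) l

theorem placed_append {P : Program} {l₁ l₂ : Program} {o : ℕ} :
    Placed P o (l₁ ++ l₂) ↔ Placed P o l₁ ∧ Placed P (o + l₁.length) l₂ := by
  induction l₁ generalizing o with
  | nil => simp [Placed]
  | cons I l ih =>
    simp only [List.cons_append, Placed, ih, List.length_cons, and_assoc]
    rw [show o + 1 + l.length = o + (l.length + 1) by omega]

theorem placed_of_append (l₁ l₂ : Program) : Placed (l₁ ++ l₂) l₁.length l₂ := by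
  induction l₂ generalizing l₁ with
  | nil => trivial
  | cons I l ih =>
    refine ⟨by simp, ?_⟩
    simpa using ih (l₁ ++ [I])

/-- The machine configuration `C` represents the store `s`, where the input/output region has
size `L`. -/
structure Represents (L : ℕ) (C : Config) (s : Store) : Prop where
  size : C.reg 0 = L
  reg : ∀ r, C.reg (vr r) = s.reg r
  io : ∀ i < L, C.mem i = s.io i
  arr : ∀ A i, C.mem (L + 8 * i + A.idx) = s.arr A i

/-- Started in the store `s`, the code of `c` reaches its end within `T` steps, in a store that
satisfies `Q`. -/
def Runs (L : ℕ) (c : Cmd) (s : Store) (T : ℕ) (Q : Store → Prop) : Prop :=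
  ∀ P C, Placed P C.pc (c.code C.pc) → Represents L C s →
    ∃ t ≤ T, ∃ s', Q s' ∧ Represents L ((step P)^[t] C) s' ∧
      ((step P)^[t] C).pc = C.pc + (c.code C.pc).length

theorem step_eq {P : Program} {C : Config} {I : Instr} (h : P[C.pc]? = some I) :
    step P C = I.exec C := by
  simp [step, h]

theorem iterate_step {P : Program} {C : Config} {I : Instr} (h : P[C.pc]? = some I) (t : ℕ) :
    (step P)^[t + 1] C = (step P)^[t] (I.exec C) := by
  rw [Function.iterate_succ_apply, step_eq h]

theorem Runs.mono {L : ℕ} {c : Cmd} {s : Store} {T T' : ℕ} {Q Q' : Store → Prop}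
    (h : Runs L c s T Q) (hT : T ≤ T') (hQ : ∀ s, Q s → Q' s) : Runs L c s T' Q' := by
  intro P C hP hC
  obtain ⟨t, ht, s', hs', h'⟩ := h P C hP hC
  exact ⟨t, ht.trans hT, s', hQ _ hs', h'⟩

theorem Runs.seq {L : ℕ} {c₁ c₂ : Cmd} {s : Store} {T₁ T₂ : ℕ} {Q R : Store → Prop}
    (h₁ : Runs L c₁ s T₁ Q) (h₂ : ∀ s', Q s' → Runs L c₂ s' T₂ R) :
    Runs L (c₁ ;; c₂) s (T₁ + T₂) R := by
  intro P C hP hC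
  rw [code, placed_append] at hP
  obtain ⟨t, ht, s', hs', hR, hpc⟩ := h₁ P C hP.1 hC
  obtain ⟨t', ht', s'', hs'', hR', hpc'⟩ := h₂ s' hs' P ((step P)^[t] C) (by rw [hpc]; exact hP.2) hR
  rw [← Function.iterate_add_apply] at hR' hpc'
  refine ⟨t' + t, by omega, s'', hs'', hR', ?_⟩
  rw [hpc', hpc, code, List.length_append]
  omega

theorem Runs.ifZero {L : ℕ} {r : Var} {c₁ c₂ : Cmd} {s : Store} {T : ℕ} {Q : Store → Prop}
    (h₁ : s.reg r = 0 → Runs L c₁ s T Q) (h₂ : s.reg r ≠ 0 → Runs L c₂ s T Q) :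
    Runs L (ifZero r c₁ c₂) s (T + 2) Q := by
  intro P C hP hC
  simp only [code, Placed, placed_append] at hP
  obtain ⟨hj, h2, hj', h1⟩ := hP
  have hstep := step_eq hj
  simp only [Instr.exec] at hstep
  by_cases hr : s.reg r = 0
  · rw [hC.reg r, if_pos hr] at hstep
    obtain ⟨t, ht, s', hs', hR, hpc⟩ := h₁ hr P (step P C)
      (by rw [hstep]; exact h1) ⟨by simp [hstep, hC.size], by simp [hstep, hC.reg],
        by simp only [hstep]; exact hC.io, by simp [hstep, hC.arr]⟩
    rw [← Function.iterate_succ_apply] at hR hpc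
    refine ⟨t + 1, by omega, s', hs', hR, ?_⟩
    rw [hpc, hstep]
    simp only [code, List.length_cons, List.length_append]
    omega
  · rw [hC.reg r, if_neg hr] at hstep
    obtain ⟨t, ht, s', hs', hR, hpc⟩ := h₂ hr P (step P C)
      (by rw [hstep]; exact h2) ⟨by simp [hstep, hC.size], by simp [hstep, hC.reg],
        by simp only [hstep]; exact hC.io, by simp [hstep, hC.arr]⟩
    rw [← Function.iterate_succ_apply] at hR hpc
    have hstep' : step P ((step P)^[t + 1] C) = _ :=
      step_eq (by rw [hpc, hstep]; exact hj')
    rw [← Function.iterate_succ_apply' (step P)] at hstep'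
    simp only [Instr.exec] at hstep'
    refine ⟨t + 1 + 1, by omega, s', hs', ?_, ?_⟩
    · rw [hstep']
      exact ⟨hR.size, hR.reg, hR.io, hR.arr⟩
    · rw [hstep']
      simp only [code, List.length_cons, List.length_append]
      omega

/-- The rule for loops. The invariant carries a bound on the number of iterations that are left. -/
theorem Runs.loop {L : ℕ} {r : Var} {c : Cmd} {T : ℕ} (Inv : ℕ → Store → Prop)
    (h : ∀ N s, Inv N s → s.reg r ≠ 0 → Runs L c s T fun s' => ∃ N' < N, Inv N' s')
    {N : ℕ} {s : Store} (hs : Inv N s) :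
    Runs L (.loop r c) s ((T + 2) * N + 1) fun s' => s'.reg r = 0 ∧ ∃ N', Inv N' s' := by
  induction N using Nat.strong_induction_on generalizing s with
  | _ N ih =>
    intro P C hP hC
    have hP' := hP
    simp only [code, Placed, placed_append] at hP
    obtain ⟨hj, hc, hj', -⟩ := hP
    have hstep := step_eq hj
    simp only [Instr.exec] at hstep
    by_cases hr : s.reg r = 0
    · rw [hC.reg r, if_pos hr] at hstep
      refine ⟨1, by omega, s, ⟨hr, N, hs⟩, ?_, ?_⟩
      · rw [Function.iterate_one, hstep]
        exact ⟨hC.size, hC.reg, hC.io, hC.arr⟩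
      · rw [Function.iterate_one, hstep]
        simp only [code, List.length_cons, List.length_append, List.length_nil]
        omega
    · rw [hC.reg r, if_neg hr] at hstep
      obtain ⟨t, ht, s', ⟨N', hN', hs'⟩, hR, hpc⟩ := h N s hs hr P (step P C)
        (by rw [hstep]; exact hc) ⟨by simp [hstep, hC.size], by simp [hstep, hC.reg],
          by simp only [hstep]; exact hC.io, by simp [hstep, hC.arr]⟩
      rw [← Function.iterate_succ_apply] at hR hpc
      have hstep' : step P ((step P)^[t + 1] C) = _ :=
        step_eq (by rw [hpc, hstep]; exact hj')
      rw [← Function.iterate_succ_apply' (step P)] at hstep'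
      simp only [Instr.exec] at hstep'
      obtain ⟨t', ht', s'', hs'', hR', hpc'⟩ := ih N' hN' hs' P ((step P)^[t + 1 + 1] C)
        (by rw [hstep']; exact hP') (by rw [hstep']; exact ⟨hR.size, hR.reg, hR.io, hR.arr⟩)
      rw [← Function.iterate_add_apply] at hR' hpc'
      refine ⟨t' + (t + 1 + 1), ?_, s'', hs'', hR', ?_⟩
      · have : (T + 2) * (N' + 1) ≤ (T + 2) * N := Nat.mul_le_mul_left _ hN'
        rw [mul_add] at this
        omega
      · rw [hpc', hstep']

/-! ### Verification conditions for code without loops -/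

/-- The weakest precondition of a command without loops. -/
def vc (L : ℕ) : Cmd → (Store → Prop) → Store → Prop
  | const r k, Q, s => Q (s.setReg r k)
  | add r a b, Q, s => Q (s.setReg r (s.reg a + s.reg b))
  | sub r a b, Q, s => Q (s.setReg r (s.reg a - s.reg b))
  | get r a, Q, s => s.reg a < L ∧ Q (s.setReg r (s.io (s.reg a)))
  | put a r, Q, s => s.reg a < L ∧ Q (s.setIo (s.reg a) (s.reg r))
  | load A r a, Q, s => Q (s.setReg r (s.arr A (s.reg a)))
  | store A a r, Q, s => Q (s.setArr A (s.reg a) (s.reg r))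
  | seq c₁ c₂, Q, s => c₁.vc L (c₂.vc L Q) s
  | ifZero r c₁ c₂, Q, s => (s.reg r = 0 → c₁.vc L Q s) ∧ (s.reg r ≠ 0 → c₂.vc L Q s)
  | .loop _ _, _, _ => False

/-- A bound on the running time of a command without loops. -/
def cost : Cmd → ℕ
  | load _ _ _ | store _ _ _ => 7
  | seq c₁ c₂ => c₁.cost + c₂.cost
  | ifZero _ c₁ c₂ => max c₁.cost c₂.cost + 2
  | _ => 1

theorem vr_ne (r : Var) : vr r ≠ 0 ∧ vr r ≠ 1 ∧ vr r ≠ 2 := by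
  unfold vr; omega

theorem Represents.setReg {L : ℕ} {C : Config} {s : Store} (h : Represents L C s) (r : Var)
    (k pc : ℕ) : Represents L ⟨pc, Function.update C.reg (vr r) k, C.mem⟩ (s.setReg r k) where
  size := by
    dsimp only
    rw [Function.update_of_ne (vr_ne r).1.symm]
    exact h.size
  reg r' := by
    by_cases hr : r' = r
    · simp [hr]
    · have : vr r' ≠ vr r := fun h' => hr (Var.idx_inj (by unfold vr at h'; omega))
      simp [hr, this, h.reg]
  io := h.io
  arr := h.arr

theorem Represents.setIo {L : ℕ} {C : Config} {s : Store} (h : Represents L C s) {i : ℕ}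
    (hi : i < L) (k pc : ℕ) : Represents L ⟨pc, C.reg, Function.update C.mem i k⟩ (s.setIo i k) where
  size := h.size
  reg := h.reg
  io j hj := by simp only [Function.update_apply, Store.setIo_io, h.io j hj]
  arr A j := by
    dsimp only
    rw [Function.update_of_ne (by omega)]
    exact h.arr A j

theorem Represents.setArr {L : ℕ} {C : Config} {s : Store} (h : Represents L C s) (A : Arr)
    (i k pc : ℕ) : Represents L ⟨pc, C.reg, Function.update C.mem (L + 8 * i + A.idx) k⟩
      (s.setArr A i k) where
  size := h.size
  reg := h.reg
  io j hj := by
    dsimp only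
    rw [Function.update_of_ne (by omega)]
    exact h.io j hj
  arr B j := by
    have hA := A.idx_lt
    have hB := B.idx_lt
    by_cases hAB : B = A
    · subst hAB
      simp only [Function.update_apply, Store.setArr_arr, if_true, ← h.arr B j]
      by_cases hij : j = i
      · simp [hij]
      · rw [if_neg (by omega), if_neg hij]
    · have : B.idx ≠ A.idx := fun h' => hAB (Arr.idx_inj h')
      simp only [Store.setArr_arr, hAB, if_false, ← h.arr B j]
      rw [Function.update_of_ne (by omega)]

theorem addrCode_run {L : ℕ} {C : Config} {s : Store} {P : Program} {A : Arr} {a : Var}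
    (hP : Placed P C.pc (addrCode A a)) (h : Represents L C s) :
    ∃ C', (step P)^[6] C = C' ∧ C'.pc = C.pc + 6 ∧ C'.reg 1 = L + 8 * s.reg a + A.idx ∧
      C'.mem = C.mem ∧ Represents L C' s := by
  obtain ⟨h0, h1, h2, h3, h4, h5, -⟩ := hP
  refine ⟨_, rfl, ?_⟩
  have e : (step P)^[6] C = ⟨C.pc + 6, Function.update (Function.update C.reg 2 A.idx) 1
      (L + 8 * s.reg a + A.idx), C.mem⟩ := by
    rw [iterate_step h0, iterate_step (I := .add 1 1 1) h1, iterate_step (I := .add 1 1 1) h2,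
      iterate_step (I := .add 1 1 0) h3, iterate_step (I := .const 2 A.idx) h4,
      iterate_step (I := .add 1 1 2) h5]
    simp only [Function.iterate_zero, id]
    simp only [Instr.exec, Config.mk.injEq, and_true, true_and]
    funext r
    have hs := h.size
    have ha := h.reg a
    simp only [Function.update_apply]
    split_ifs <;> first | rfl | (simp_all; try omega)
  rw [e]
  refine ⟨rfl, by simp, rfl, ?_, ?_, h.io, h.arr⟩
  · simpa using h.size
  · intro r
    have := vr_ne r
    simp [this, h.reg]

/-- The code of a command without loops behaves as its verification condition says. -/
theorem runs_of_vc {L : ℕ} (c : Cmd) {s : Store} {Q : Store → Prop} (h : c.vc L Q s) :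
    Runs L c s c.cost Q := by
  induction c generalizing s Q with
  | const r k =>
    intro P C hP hC
    refine ⟨1, le_rfl, _, h, ?_⟩
    rw [Function.iterate_one, step_eq hP.1]
    exact ⟨hC.setReg r k _, rfl⟩
  | add r a b =>
    intro P C hP hC
    refine ⟨1, le_rfl, _, h, ?_⟩
    rw [Function.iterate_one, step_eq hP.1, ← hC.reg a, ← hC.reg b]
    exact ⟨hC.setReg r _ _, rfl⟩
  | sub r a b =>
    intro P C hP hC
    refine ⟨1, le_rfl, _, h, ?_⟩
    rw [Function.iterate_one, step_eq hP.1, ← hC.reg a, ← hC.reg b]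
    exact ⟨hC.setReg r _ _, rfl⟩
  | get r a =>
    intro P C hP hC
    refine ⟨1, le_rfl, _, h.2, ?_⟩
    rw [Function.iterate_one, step_eq hP.1, ← hC.io _ h.1, ← hC.reg a]
    exact ⟨hC.setReg r _ _, rfl⟩
  | put a r =>
    intro P C hP hC
    refine ⟨1, le_rfl, _, h.2, ?_⟩
    have hlt := h.1
    rw [← hC.reg a] at hlt ⊢
    rw [Function.iterate_one, step_eq hP.1, ← hC.reg r]
    exact ⟨hC.setIo hlt _ _, rfl⟩
  | load A r a =>
    intro P C hP hC
    rw [code, placed_append] at hP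
    obtain ⟨C', e, hpc, h1, hmem, hC'⟩ := addrCode_run hP.1 hC
    refine ⟨7, le_rfl, _, h, ?_⟩
    have hI : P[C'.pc]? = some (.load (vr r) 1) := by rw [hpc]; exact hP.2.1
    rw [Function.iterate_succ_apply', e, step_eq hI, ← hC'.arr, ← h1]
    exact ⟨hC'.setReg r _ _, by simp [Instr.exec, hpc, code, addrCode]⟩
  | store A a r =>
    intro P C hP hC
    rw [code, placed_append] at hP
    obtain ⟨C', e, hpc, h1, hmem, hC'⟩ := addrCode_run hP.1 hC
    refine ⟨7, le_rfl, _, h, ?_⟩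
    have hI : P[C'.pc]? = some (.store 1 (vr r)) := by rw [hpc]; exact hP.2.1
    rw [Function.iterate_succ_apply', e, step_eq hI, ← hC'.reg r]
    simp only [Instr.exec]
    rw [h1]
    exact ⟨hC'.setArr A _ _ _, by simp [hpc, code, addrCode]⟩
  | seq c₁ c₂ h₁ h₂ => exact (h₁ h).seq fun s' hs' => h₂ hs'
  | ifZero r c₁ c₂ h₁ h₂ =>
    exact Runs.ifZero (fun hr => (h₁ (h.1 hr)).mono (le_max_left _ _) fun _ => id)
      fun hr => (h₂ (h.2 hr)).mono (le_max_right _ _) fun _ => id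
  | loop r c _ => exact h.elim

end Cmd

/-! ### Linked lists -/

/-- The pointer `h` is the head of a linked list that holds `l`. The null pointer is `0`, the pointer
to the item `i` is `i + 1`, and `nxt i` is the pointer to the item after `i`. -/
def Chain (nxt : ℕ → ℕ) : ℕ → List ℕ → Prop
  | h, [] => h = 0
  | h, i :: l => h = i + 1 ∧ Chain nxt (nxt i) l

theorem Chain.update {nxt : ℕ → ℕ} {h : ℕ} {l : List ℕ} (hl : Chain nxt h l) {i : ℕ} (hi : i ∉ l)
    (k : ℕ) : Chain (Function.update nxt i k) h l := by
  induction l generalizing h with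
  | nil => exact hl
  | cons j l ih =>
    simp only [List.mem_cons, not_or] at hi
    refine ⟨hl.1, ?_⟩
    rw [Function.update_of_ne (Ne.symm hi.1)]
    exact ih hl.2 hi.2

theorem Chain.push {nxt : ℕ → ℕ} {h : ℕ} {l : List ℕ} (hl : Chain nxt h l) {i : ℕ} (hi : i ∉ l) :
    Chain (Function.update nxt i h) (i + 1) (i :: l) :=
  ⟨rfl, by rw [Function.update_self]; exact hl.update hi h⟩

theorem Chain.eq_nil {nxt : ℕ → ℕ} {h : ℕ} {l : List ℕ} (hl : Chain nxt h l) (h0 : h = 0) :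
    l = [] := by
  cases l with
  | nil => rfl
  | cons i l => have := hl.1; omega

theorem Chain.eq_cons {nxt : ℕ → ℕ} {h : ℕ} {l : List ℕ} (hl : Chain nxt h l) (h0 : h ≠ 0) :
    ∃ l', l = (h - 1) :: l' ∧ Chain nxt (nxt (h - 1)) l' := by
  cases l with
  | nil => exact absurd hl h0
  | cons i l =>
    obtain ⟨rfl, hl⟩ := hl
    exact ⟨l, rfl, hl⟩

/-- The items `i < j` with the key `t`, in descending order. -/
def bucket (key : ℕ → ℕ) (j t : ℕ) : List ℕ :=
  ((List.range j).filter fun i => key i = t).reverse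

theorem mem_bucket {key : ℕ → ℕ} {j t i : ℕ} : i ∈ bucket key j t ↔ i < j ∧ key i = t := by
  simp [bucket]

theorem nodup_bucket (key : ℕ → ℕ) (j t : ℕ) : (bucket key j t).Nodup := by
  rw [bucket, List.nodup_reverse]
  exact List.nodup_range.filter _

theorem bucket_succ (key : ℕ → ℕ) (j t : ℕ) :
    bucket key (j + 1) t = if key j = t then j :: bucket key j t else bucket key j t := by
  simp only [bucket, List.range_succ, List.filter_append, List.reverse_append]
  split_ifs with h <;> simp [h]

/-- For every key `t`, the items `i < j` with the key `t` form a linked list with the head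
`head t`. -/
def Buckets (head nxt key : ℕ → ℕ) (j : ℕ) : Prop := ∀ t, Chain nxt (head t) (bucket key j t)

theorem buckets_zero (nxt key : ℕ → ℕ) : Buckets (fun _ => 0) nxt key 0 := fun _ => rfl

theorem Buckets.insert {head nxt key : ℕ → ℕ} {j : ℕ} (h : Buckets head nxt key j) :
    Buckets (Function.update head (key j) (j + 1)) (Function.update nxt j (head (key j))) key
      (j + 1) := by
  intro t
  have hj : ∀ t, j ∉ bucket key j t := fun t => by simp [mem_bucket]
  rw [bucket_succ]
  split_ifs with ht
  · subst ht
    rw [Function.update_self]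
    exact (h _).push (hj _)
  · rw [Function.update_of_ne (Ne.symm ht)]
    exact (h t).update (hj t) _

/-! ### The invariant of the attractor computation -/

/-- A game given by arrays: the edge `e < m` leads from `src e < n` to `tgt e < n`, and the state
`u < n` has the owner `own u` and the priority `pr u < d`. -/
structure ArrayGame where
  n : ℕ
  m : ℕ
  d : ℕ
  src : ℕ → ℕ
  tgt : ℕ → ℕ
  own : ℕ → ℕ
  pr : ℕ → ℕ
  src_lt : ∀ e < m, src e < n
  tgt_lt : ∀ e < m, tgt e < n
  pr_lt : ∀ u < n, pr u < d
  exists_edge : ∀ u < n, ∃ e < m, src e = u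

/-- The player who wins the states of stage `j`. Stages are counted from `1`, so that stage `j`
treats the priority `j - 1`. -/
def stageWinner (j : ℕ) : ℕ := 2 - j % 2

theorem stageWinner_eq (j : ℕ) : stageWinner j = 1 ∨ stageWinner j = 2 := by
  unfold stageWinner; omega

namespace ArrayGame

variable (A : ArrayGame)

/-- Local conditions on a state `u` of stage `st u ≠ 0` that show, once they hold for all states,
that `u` is won by the player `stageWinner (st u)`. The stage `0` stands for "not yet known", and
`τ` is the time at which the stage of a state was fixed. -/
structure Justified (st τ : ℕ → ℕ) (u : ℕ) : Prop where
  le_prio : st u ≤ A.pr u + 1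
  /-- The owner can stay in the part of the game that stage `st u` started with. -/
  stay : ∃ e < A.m, A.src e = u ∧ (st (A.tgt e) = 0 ∨ st u ≤ st (A.tgt e))
  /-- The owner cannot leave that part to a state that he wins. -/
  leave : ∀ e < A.m, A.src e = u →
    st (A.tgt e) = 0 ∨ st u ≤ st (A.tgt e) ∨ stageWinner (st (A.tgt e)) ≠ A.own u
  /-- The winner, if he is the owner, can come closer to the priority `st u - 1`. -/
  attract : A.pr u + 1 ≠ st u → A.own u = stageWinner (st u) →
    ∃ e < A.m, A.src e = u ∧ st (A.tgt e) = st u ∧ τ (A.tgt e) < τ u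
  /-- The loser, if he is the owner, has to go to a state that got its stage earlier. -/
  forced : A.pr u + 1 ≠ st u → A.own u ≠ stageWinner (st u) →
    ∀ e < A.m, A.src e = u → st (A.tgt e) ≠ 0 ∧ st (A.tgt e) ≤ st u ∧ τ (A.tgt e) < τ u

/-- The edge `e` has not yet been taken into account at its source: its target has no stage or
waits on the stack, or `e` is in the list `cur` of edges that is being scanned. -/
def Pending (st : ℕ → ℕ) (cur stack : List ℕ) (e : ℕ) : Prop :=
  st (A.tgt e) = 0 ∨ A.tgt e ∈ stack ∨ e ∈ cur

open Classical in
/-- The pending edges out of `u`. -/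
noncomputable def pendingFrom (st : ℕ → ℕ) (cur stack : List ℕ) (u : ℕ) : Finset ℕ :=
  {e ∈ Finset.range A.m | A.src e = u ∧ A.Pending st cur stack e}

variable {A} in
theorem mem_pendingFrom {st : ℕ → ℕ} {cur stack : List ℕ} {u e : ℕ} :
    e ∈ A.pendingFrom st cur stack u ↔ e < A.m ∧ A.src e = u ∧ A.Pending st cur stack e := by
  simp [pendingFrom]

/-- The invariant of the attractor computation in stage `j`. The states on the stack belong to stage
`j` and their incoming edges have not been scanned, the edges in `cur` lead to a state of stage `j`,
and `q` holds the states of priority `j - 1` that have not been looked at. -/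
structure Inv (st cnt τ : ℕ → ℕ) (j : ℕ) (cur stack q : List ℕ) : Prop where
  st_le : ∀ u < A.n, st u ≤ j
  j_le : ∀ u < A.n, st u = 0 → j ≤ A.pr u + 1
  mem_q : ∀ u < A.n, st u = 0 → A.pr u + 1 = j → u ∈ q
  q_spec : ∀ u ∈ q, u < A.n ∧ A.pr u + 1 = j
  cnt_eq : ∀ u < A.n, st u = 0 → cnt u = (A.pendingFrom st cur stack u).card
  cnt_ne : ∀ u < A.n, st u = 0 → cnt u ≠ 0
  stack_spec : ∀ t ∈ stack, t < A.n ∧ st t = j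
  stack_nodup : stack.Nodup
  cur_spec : ∀ e ∈ cur, e < A.m ∧ st (A.tgt e) = j ∧ A.tgt e ∉ stack
  cur_nodup : cur.Nodup
  owner_ne : ∀ e < A.m, st (A.src e) = 0 → ¬ A.Pending st cur stack e →
    stageWinner (st (A.tgt e)) ≠ A.own (A.src e)
  justified : ∀ u < A.n, st u ≠ 0 → A.Justified st τ u

open Classical in
/-- A bound on the number of steps that the attractor computation can still make. -/
noncomputable def potential (st : ℕ → ℕ) (j : ℕ) (cur stack q : List ℕ) : ℕ :=
  (Finset.filter (A.Pending st cur stack) (Finset.range A.m)).card +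
    (Finset.filter (fun u => st u = 0 ∨ u ∈ stack) (Finset.range A.n)).card +
    (q.length + (Finset.filter (fun u => j ≤ A.pr u) (Finset.range A.n)).card) + (A.d + 1 - j)

theorem potential_le (st : ℕ → ℕ) (stack : List ℕ) :
    A.potential st 0 [] stack [] ≤ A.m + 2 * A.n + A.d + 1 := by
  classical
  unfold potential
  have h1 := (Finset.card_filter_le (Finset.range A.m) (A.Pending st [] stack))
  have h2 := (Finset.card_filter_le (Finset.range A.n) (fun u => st u = 0 ∨ u ∈ stack))
  have h3 := (Finset.card_filter_le (Finset.range A.n) (fun u => 0 ≤ A.pr u))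
  simp only [Finset.card_range, List.length_nil] at *
  omega

variable {A} {st cnt τ : ℕ → ℕ} {j : ℕ} {cur stack q : List ℕ}

/-- Initially no state has a stage and all edges are pending. -/
theorem Inv.initial (hcnt : ∀ u, cnt u = ((Finset.range A.m).filter fun e => A.src e = u).card) :
    A.Inv (fun _ => 0) cnt τ 0 [] [] [] where
  st_le _ _ := le_rfl
  j_le _ _ _ := Nat.zero_le _
  mem_q _ _ _ h := by omega
  q_spec _ h := by simp at h
  cnt_eq u _ _ := by
    rw [hcnt]
    congr 1
    ext e
    simp [mem_pendingFrom, Pending]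
  cnt_ne u hu _ := by
    obtain ⟨e, he, h⟩ := A.exists_edge u hu
    rw [hcnt]
    exact Finset.card_ne_zero_of_mem (a := e) (by simp [he, h])
  stack_spec _ h := by simp at h
  stack_nodup := List.nodup_nil
  cur_spec _ h := by simp at h
  cur_nodup := List.nodup_nil
  owner_ne e _ _ h := by simp [Pending] at h
  justified _ _ h := absurd rfl h

theorem Inv.stage_of_pending (h : A.Inv st cnt τ j cur stack q) {e : ℕ}
    (he : A.Pending st cur stack e) : st (A.tgt e) = 0 ∨ st (A.tgt e) = j := by
  rcases he with he | he | he
  · exact Or.inl he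
  · exact Or.inr (h.stack_spec _ he).2
  · exact Or.inr (h.cur_spec _ he).2.1

theorem pending_assign {v : ℕ} (hv : st v = 0) (e : ℕ) :
    A.Pending (Function.update st v j) cur (v :: stack) e ↔ A.Pending st cur stack e := by
  unfold Pending
  by_cases h : A.tgt e = v
  · simp [h, hv]
  · simp [h]

/-- The stage of `v` may be set to the current stage `j` if `v` is a state of priority `j - 1`, or if
the winner of stage `j` can move from `v` to a state of stage `j`, or if his opponent has to move
from `v` to a state that already has a stage. -/
theorem Inv.assign (h : A.Inv st cnt τ j cur stack q) {v : ℕ} (hv : v < A.n) (hv0 : st v = 0)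
    (hj : j ≠ 0)
    (hreason : A.pr v + 1 = j ∨
      (A.own v = stageWinner j ∧ ∃ e < A.m, A.src e = v ∧ st (A.tgt e) = j) ∨
      (A.own v ≠ stageWinner j ∧ ∀ e < A.m, A.src e = v → st (A.tgt e) ≠ 0)) :
    ∃ τ', A.Inv (Function.update st v j) cnt τ' j cur (v :: stack) q := by
  classical
  -- `v` is later than all other states
  set T := (Finset.range A.n).sup τ + 1 with hT
  have hτ : ∀ u < A.n, τ u < T := fun u hu =>
    Nat.lt_succ_of_le (Finset.le_sup (f := τ) (Finset.mem_range.2 hu))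
  have hst : ∀ u, st u ≠ 0 → u ≠ v := by rintro u hu rfl; exact hu hv0
  have hst' : ∀ u, Function.update st v j u = 0 → st u = 0 ∧ u ≠ v := by
    intro u hu
    by_cases huv : u = v
    · subst huv; simp [hj] at hu
    · rw [Function.update_of_ne huv] at hu; exact ⟨hu, huv⟩
  have hvs : v ∉ stack := fun hm => hj (by rw [← (h.stack_spec v hm).2, hv0])
  refine ⟨Function.update τ v T, ?_⟩
  constructor
  · intro u hu
    by_cases huv : u = v
    · simp [huv]
    · rw [Function.update_of_ne huv]; exact h.st_le u hu
  · exact fun u hu hu0 => h.j_le u hu (hst' u hu0).1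
  · exact fun u hu hu0 => h.mem_q u hu (hst' u hu0).1
  · exact h.q_spec
  · intro u hu hu0
    rw [h.cnt_eq u hu (hst' u hu0).1]
    congr 1
    ext e
    rw [mem_pendingFrom, mem_pendingFrom, pending_assign hv0]
  · exact fun u hu hu0 => h.cnt_ne u hu (hst' u hu0).1
  · intro t ht
    rcases List.mem_cons.1 ht with rfl | ht
    · simp [hv]
    · have := h.stack_spec t ht
      rw [Function.update_of_ne (hst t (by omega))]
      exact this
  · exact List.nodup_cons.2 ⟨hvs, h.stack_nodup⟩
  · intro e he
    have := h.cur_spec e he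
    have hne := hst (A.tgt e) (by omega)
    rw [Function.update_of_ne hne]
    exact ⟨this.1, this.2.1, by simp [hne, this.2.2]⟩
  · exact h.cur_nodup
  · intro e he he0 hp
    rw [pending_assign hv0] at hp
    have hne := hst (A.tgt e) fun h0 => hp (Or.inl h0)
    rw [Function.update_of_ne hne]
    exact h.owner_ne e he (hst' _ he0).1 hp
  · intro u hu hu0
    by_cases huv : u = v
    · subst huv
      obtain ⟨e₀, he₀⟩ : (A.pendingFrom st cur stack u).Nonempty := by
        rw [← Finset.card_ne_zero, ← h.cnt_eq u hu hv0]
        exact h.cnt_ne u hu hv0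
      rw [mem_pendingFrom] at he₀
      refine ⟨?_, ⟨e₀, he₀.1, he₀.2.1, ?_⟩, ?_, ?_, ?_⟩
      · rw [Function.update_self]; exact h.j_le u hu hv0
      · rw [Function.update_self]
        by_cases hne : A.tgt e₀ = u
        · simp [hne]
        · rw [Function.update_of_ne hne]
          have := h.stage_of_pending he₀.2.2
          omega
      · intro e he hsrc
        rw [Function.update_self]
        by_cases hne : A.tgt e = u
        · simp [hne]
        · rw [Function.update_of_ne hne]
          by_cases hp : A.Pending st cur stack e
          · have := h.stage_of_pending hp
            omega
          · refine Or.inr (Or.inr ?_)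
            rw [← hsrc]
            exact h.owner_ne e he (by rw [hsrc]; exact hv0) hp
      · rw [Function.update_self]
        intro hp ho
        obtain ⟨e, he, hsrc, ht⟩ := ((hreason.resolve_left hp).resolve_right fun h' => h'.1 ho).2
        have hne := hst (A.tgt e) (by omega)
        refine ⟨e, he, hsrc, ?_, ?_⟩
        · rw [Function.update_of_ne hne, ht]
        · rw [Function.update_of_ne hne, Function.update_self]; exact hτ _ (A.tgt_lt e he)
      · rw [Function.update_self]
        intro hp ho e he hsrc
        have ht := ((hreason.resolve_left hp).resolve_left fun h' => ho h'.1).2 e he hsrc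
        have hne := hst (A.tgt e) ht
        rw [Function.update_of_ne hne, Function.update_of_ne hne, Function.update_self]
        exact ⟨ht, h.st_le _ (A.tgt_lt e he), hτ _ (A.tgt_lt e he)⟩
    · have hu' : st u ≠ 0 := by rwa [Function.update_of_ne huv] at hu0
      have J := h.justified u hu hu'
      have hmon : ∀ t, (st t = 0 ∨ st u ≤ st t) →
          Function.update st v j t = 0 ∨ st u ≤ Function.update st v j t := by
        intro t ht
        by_cases htv : t = v
        · subst htv
          rw [Function.update_self]
          exact Or.inr (h.st_le u hu)
        · rwa [Function.update_of_ne htv]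
      constructor
      · rw [Function.update_of_ne huv]; exact J.le_prio
      · obtain ⟨e, he, hsrc, ht⟩ := J.stay
        refine ⟨e, he, hsrc, ?_⟩
        rw [Function.update_of_ne huv]
        exact hmon _ ht
      · intro e he hsrc
        rw [Function.update_of_ne huv]
        rcases J.leave e he hsrc with ht | ht | ht
        · have := hmon _ (Or.inl ht); tauto
        · have := hmon _ (Or.inr ht); tauto
        · by_cases htv : A.tgt e = v
          · have := hmon _ (Or.inl (htv ▸ hv0)); tauto
          · rw [Function.update_of_ne htv]; exact Or.inr (Or.inr ht)
      · intro hp ho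
        rw [Function.update_of_ne huv] at hp ho
        obtain ⟨e, he, hsrc, ht, hlt⟩ := J.attract hp ho
        have hne := hst (A.tgt e) (by omega)
        refine ⟨e, he, hsrc, ?_⟩
        rw [Function.update_of_ne huv, Function.update_of_ne hne, Function.update_of_ne huv,
          Function.update_of_ne hne]
        exact ⟨ht, hlt⟩
      · intro hp ho e he hsrc
        rw [Function.update_of_ne huv] at hp ho
        have ht := J.forced hp ho e he hsrc
        have hne := hst (A.tgt e) ht.1
        rw [Function.update_of_ne huv, Function.update_of_ne hne, Function.update_of_ne huv,
          Function.update_of_ne hne]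
        exact ht

theorem potential_assign {v : ℕ} (hv0 : st v = 0) :
    A.potential (Function.update st v j) j cur (v :: stack) q = A.potential st j cur stack q := by
  classical
  unfold potential
  congr 3
  · congr 1
    exact Finset.filter_congr fun e _ => pending_assign hv0 e
  · congr 1
    refine Finset.filter_congr fun u _ => ?_
    by_cases huv : u = v
    · simp [huv, hv0]
    · simp [huv]

theorem Inv.not_pending_of_cons {e : ℕ} (h : A.Inv st cnt τ j (e :: cur) stack q) (hj : j ≠ 0) :
    ¬ A.Pending st cur stack e := by
  have := h.cur_spec e (by simp)
  have hn := (List.nodup_cons.1 h.cur_nodup).1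
  rintro (h' | h' | h')
  · omega
  · exact this.2.2 h'
  · exact hn h'

theorem pending_cons {e e' : ℕ} (he : e' ≠ e) :
    A.Pending st (e :: cur) stack e' ↔ A.Pending st cur stack e' := by
  simp [Pending, he]

theorem pendingFrom_cons {e : ℕ} (h : A.Inv st cnt τ j (e :: cur) stack q) (hj : j ≠ 0) (u : ℕ) :
    A.pendingFrom st cur stack u = (A.pendingFrom st (e :: cur) stack u).erase e := by
  ext e'
  rw [Finset.mem_erase, mem_pendingFrom, mem_pendingFrom]
  by_cases he : e' = e
  · subst he
    simp [h.not_pending_of_cons hj]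
  · rw [pending_cons he]
    tauto

/-- The edge `e` at the head of the list that is being scanned may be removed from it if its source
has a stage. -/
theorem Inv.skip_edge {e : ℕ} (h : A.Inv st cnt τ j (e :: cur) stack q) (hj : j ≠ 0)
    (hs : st (A.src e) ≠ 0) : A.Inv st cnt τ j cur stack q where
  __ := h
  cnt_eq u hu hu0 := by
    rw [h.cnt_eq u hu hu0, pendingFrom_cons h hj, Finset.erase_eq_of_notMem]
    rw [mem_pendingFrom]
    rintro ⟨-, rfl, -⟩
    exact hs hu0
  cur_spec e' he' := h.cur_spec e' (by simp [he'])
  cur_nodup := (List.nodup_cons.1 h.cur_nodup).2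
  owner_ne e' he' h0 hp := by
    refine h.owner_ne e' he' h0 ?_
    rwa [pending_cons]
    rintro rfl
    exact hs h0

/-- The edge `e` at the head of the list that is being scanned may be removed from it after
decrementing the counter of its source, if the source belongs to the loser of stage `j` and has other
pending edges. -/
theorem Inv.count_edge {e : ℕ} (h : A.Inv st cnt τ j (e :: cur) stack q) (hj : j ≠ 0)
    (ho : A.own (A.src e) ≠ stageWinner j) (hc : cnt (A.src e) - 1 ≠ 0) :
    A.Inv st (Function.update cnt (A.src e) (cnt (A.src e) - 1)) τ j cur stack q where
  __ := h
  cnt_eq u hu hu0 := by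
    have hu' := h.cnt_eq u hu hu0
    have hecur := h.cur_spec e (by simp)
    rw [pendingFrom_cons h hj]
    by_cases hue : u = A.src e
    · subst hue
      rw [Function.update_self, Finset.card_erase_of_mem, hu']
      exact mem_pendingFrom.2 ⟨hecur.1, rfl, Or.inr (Or.inr (by simp))⟩
    · rw [Function.update_of_ne hue, hu', Finset.erase_eq_of_notMem]
      rw [mem_pendingFrom]
      rintro ⟨-, rfl, -⟩
      exact hue rfl
  cnt_ne u hu hu0 := by
    by_cases hue : u = A.src e
    · rw [hue, Function.update_self]; exact hc
    · rw [Function.update_of_ne hue]; exact h.cnt_ne u hu hu0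
  cur_spec e' he' := h.cur_spec e' (by simp [he'])
  cur_nodup := (List.nodup_cons.1 h.cur_nodup).2
  owner_ne e' he' h0 hp := by
    by_cases hee : e' = e
    · subst hee
      rw [(h.cur_spec e' (by simp)).2.1]
      exact ho.symm
    · exact h.owner_ne e' he' h0 (by rwa [pending_cons hee])

/-- When the last pending edge of a state is scanned, all successors of this state have a stage. -/
theorem Inv.all_reached {e : ℕ} (h : A.Inv st cnt τ j (e :: cur) stack q) (hj : j ≠ 0)
    (hs : st (A.src e) = 0) (hc : cnt (A.src e) - 1 = 0) :
    ∀ e' < A.m, A.src e' = A.src e → st (A.tgt e') ≠ 0 := by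
  intro e' he' hsrc h0
  have hecur := h.cur_spec e (by simp)
  have hle : (A.pendingFrom st (e :: cur) stack (A.src e)).card ≤ 1 := by
    rw [← h.cnt_eq _ (A.src_lt e hecur.1) hs]; omega
  have hee := Finset.card_le_one.1 hle e' (mem_pendingFrom.2 ⟨he', hsrc, Or.inl h0⟩) e
    (mem_pendingFrom.2 ⟨hecur.1, rfl, Or.inr (Or.inr (by simp))⟩)
  rw [hee, hecur.2.1] at h0
  exact hj h0

theorem Inv.potential_edge {e : ℕ} (h : A.Inv st cnt τ j (e :: cur) stack q) (hj : j ≠ 0) :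
    A.potential st j cur stack q < A.potential st j (e :: cur) stack q := by
  classical
  unfold potential
  have : (Finset.filter (A.Pending st cur stack) (Finset.range A.m)).card <
      (Finset.filter (A.Pending st (e :: cur) stack) (Finset.range A.m)).card := by
    refine Finset.card_lt_card (Finset.ssubset_iff_of_subset ?_ |>.2 ⟨e, ?_, ?_⟩)
    · intro e'
      simp only [Finset.mem_filter]
      rintro ⟨h1, h2⟩
      refine ⟨h1, ?_⟩
      rcases h2 with h2 | h2 | h2
      · exact Or.inl h2
      · exact Or.inr (Or.inl h2)
      · exact Or.inr (Or.inr (by simp [h2]))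
    · simp [(h.cur_spec e (by simp)).1, Pending]
    · simp [h.not_pending_of_cons hj]
  omega

theorem Inv.pending_pop {t : ℕ} (e : ℕ) (he : e < A.m) :
    A.Pending st (bucket A.tgt A.m t) stack e ↔ A.Pending st [] (t :: stack) e := by
  simp only [Pending, mem_bucket, he, List.mem_cons, true_and, List.not_mem_nil, or_false]
  tauto

/-- After the last edge has been scanned, the next state is taken from the stack. -/
theorem Inv.pop {t : ℕ} (h : A.Inv st cnt τ j [] (t :: stack) q) :
    A.Inv st cnt τ j (bucket A.tgt A.m t) stack q where
  __ := h
  cnt_eq u hu hu0 := by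
    rw [h.cnt_eq u hu hu0]
    congr 1
    ext e
    rw [mem_pendingFrom, mem_pendingFrom]
    refine and_congr_right fun he => ?_
    rw [Inv.pending_pop e he]
  stack_spec t' ht' := h.stack_spec t' (by simp [ht'])
  stack_nodup := (List.nodup_cons.1 h.stack_nodup).2
  cur_spec e he := by
    obtain ⟨hem, rfl⟩ := mem_bucket.1 he
    exact ⟨hem, (h.stack_spec _ (by simp)).2, (List.nodup_cons.1 h.stack_nodup).1⟩
  cur_nodup := nodup_bucket _ _ _
  owner_ne e he h0 hp := h.owner_ne e he h0 (by rwa [Inv.pending_pop e he] at hp)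

theorem Inv.potential_pop {t : ℕ} (h : A.Inv st cnt τ j [] (t :: stack) q) (hj : j ≠ 0) :
    A.potential st j (bucket A.tgt A.m t) stack q < A.potential st j [] (t :: stack) q := by
  classical
  unfold potential
  have h1 : Finset.filter (A.Pending st (bucket A.tgt A.m t) stack) (Finset.range A.m) =
      Finset.filter (A.Pending st [] (t :: stack)) (Finset.range A.m) :=
    Finset.filter_congr fun e he => Inv.pending_pop e (Finset.mem_range.1 he)
  have h2 : (Finset.filter (fun u => st u = 0 ∨ u ∈ stack) (Finset.range A.n)).card <
      (Finset.filter (fun u => st u = 0 ∨ u ∈ t :: stack) (Finset.range A.n)).card := by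
    have ht := h.stack_spec t (by simp)
    refine Finset.card_lt_card (Finset.ssubset_iff_of_subset ?_ |>.2 ⟨t, ?_, ?_⟩)
    · intro u
      simp only [Finset.mem_filter, List.mem_cons]
      tauto
    · simp [ht.1]
    · simp [(List.nodup_cons.1 h.stack_nodup).1, ht.2, hj]
  rw [h1]
  omega

/-- A state of the current priority may be dropped if it has a stage. -/
theorem Inv.drop_seed {v : ℕ} (h : A.Inv st cnt τ j cur stack (v :: q)) (hv : st v ≠ 0) :
    A.Inv st cnt τ j cur stack q where
  __ := h
  mem_q u hu hu0 hp := by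
    rcases List.mem_cons.1 (h.mem_q u hu hu0 hp) with rfl | h'
    · exact absurd hu0 hv
    · exact h'
  q_spec u hu := h.q_spec u (by simp [hu])

theorem potential_drop_seed {v : ℕ} :
    A.potential st j cur stack q < A.potential st j cur stack (v :: q) := by
  unfold potential
  simp only [List.length_cons]
  omega

/-- When nothing is left to be done, the next stage starts. -/
theorem Inv.next_stage (h : A.Inv st cnt τ j [] [] []) :
    A.Inv st cnt τ (j + 1) [] [] (bucket A.pr A.n j) where
  __ := h
  st_le u hu := (h.st_le u hu).trans (Nat.le_succ j)
  j_le u hu hu0 := by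
    have h1 := h.j_le u hu hu0
    have h2 := h.mem_q u hu hu0
    simp only [List.not_mem_nil, imp_false] at h2
    omega
  mem_q u hu _ hp := mem_bucket.2 ⟨hu, by omega⟩
  q_spec u hu := by
    have := mem_bucket.1 hu
    exact ⟨this.1, by omega⟩
  stack_spec _ ht := by simp at ht
  cur_spec _ he := by simp at he

theorem potential_next_stage (hj : j ≤ A.d) :
    A.potential st (j + 1) cur stack (bucket A.pr A.n j) < A.potential st j cur stack [] := by
  classical
  unfold potential
  have h1 : (bucket A.pr A.n j).length = (Finset.filter (fun u => A.pr u = j) (Finset.range A.n)).card := by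
    rw [← List.toFinset_card_of_nodup (nodup_bucket _ _ _)]
    congr 1
    ext u
    simp [mem_bucket]
  have h2 : (Finset.filter (fun u => j ≤ A.pr u) (Finset.range A.n)).card =
      (Finset.filter (fun u => A.pr u = j) (Finset.range A.n)).card +
      (Finset.filter (fun u => j + 1 ≤ A.pr u) (Finset.range A.n)).card := by
    rw [← Finset.card_union_of_disjoint]
    · congr 1
      ext u
      simp only [Finset.mem_filter, Finset.mem_union]
      have : j ≤ A.pr u ↔ A.pr u = j ∨ j + 1 ≤ A.pr u := by omega
      tauto
    · rw [Finset.disjoint_filter]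
      intro u _ hu
      omega
  simp only [List.length_nil]
  omega

end ArrayGame

/-! ### Justified stages determine the winning sets -/

namespace GameGraph

variable {S : Type*} (G : GameGraph S)

open Classical in
/-- The number of the player who owns the state `s`. -/
noncomputable def owner (s : S) : ℕ := if s ∈ G.S₁ then 1 else 2

/-- An assignment of stages to all states in which every state satisfies the local conditions of
`ArrayGame.Justified`. -/
structure JustifiedStages {d : ℕ} (p : S → Fin d) (st τ : S → ℕ) : Prop where
  ne_zero : ∀ s, st s ≠ 0
  le_prio : ∀ s, st s ≤ p s + 1
  stay : ∀ s, ∃ t, (s, t) ∈ G.E ∧ st s ≤ st t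
  leave : ∀ s t, (s, t) ∈ G.E → st s ≤ st t ∨ stageWinner (st t) ≠ G.owner s
  attract : ∀ s, p s + 1 ≠ st s → G.owner s = stageWinner (st s) →
    ∃ t, (s, t) ∈ G.E ∧ st t = st s ∧ τ t < τ s
  forced : ∀ s, p s + 1 ≠ st s → G.owner s ≠ stageWinner (st s) → ∀ t, (s, t) ∈ G.E →
    st t ≤ st s ∧ τ t < τ s

variable {G}
variable {d : ℕ} {p : S → Fin d} {st τ : S → ℕ}

theorem stageWinner_succ_eq_one {k : ℕ} : stageWinner (k + 1) = 1 ↔ Even k := by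
  rw [Nat.even_iff]; unfold stageWinner; omega

theorem stageWinner_succ_eq_two {k : ℕ} : stageWinner (k + 1) = 2 ↔ Odd k := by
  rw [Nat.odd_iff]; unfold stageWinner; omega

/-- The owner of `s` has a move that never decreases the stage, and that comes closer to the priority
of the stage if he is its winner. -/
theorem JustifiedStages.exists_move (h : G.JustifiedStages p st τ) (s : S) :
    ∃ t, (s, t) ∈ G.E ∧ st s ≤ st t ∧
      (p s + 1 ≠ st s → G.owner s = stageWinner (st s) → st t ≤ st s ∧ τ t < τ s) := by
  by_cases hs : p s + 1 ≠ st s ∧ G.owner s = stageWinner (st s)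
  · obtain ⟨t, ht, h1, h2⟩ := h.attract s hs.1 hs.2
    exact ⟨t, ht, h1.ge, fun _ _ => ⟨h1.le, h2⟩⟩
  · obtain ⟨t, ht, h1⟩ := h.stay s
    exact ⟨t, ht, h1, fun h2 h3 => absurd ⟨h2, h3⟩ hs⟩

/-- If player `b` always makes the moves of `JustifiedStages.exists_move`, the least priority that
occurs in a play is won by the player who wins the stage of the first state, provided this player is
`b`: the stage of the play decreases only to stages that `b` wins, and from the first state whose
stage is least the play comes closer and closer to a state with the priority of this stage. -/
theorem JustifiedStages.stageWinner_minPriority (h : G.JustifiedStages p st τ) {b : ℕ} {ω : ℕ → S}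
    (hω : ω ∈ G.plays) (h0 : stageWinner (st (ω 0)) = b)
    (hb : ∀ k, G.owner (ω k) = b → st (ω k) ≤ st (ω (k + 1)) ∧
      (p (ω k) + 1 ≠ st (ω k) → stageWinner (st (ω k)) = b →
        st (ω (k + 1)) ≤ st (ω k) ∧ τ (ω (k + 1)) < τ (ω k))) :
    stageWinner (minPriority p ω + 1) = b := by
  classical
  have howner : ∀ s, G.owner s = 1 ∨ G.owner s = 2 := fun s => by
    unfold owner; split_ifs <;> simp
  have hb12 := stageWinner_eq (st (ω 0))
  rw [h0] at hb12
  -- whenever the stage decreases, the new stage is won by `b`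
  have hdec : ∀ k, st (ω k) ≤ st (ω (k + 1)) ∨ stageWinner (st (ω (k + 1))) = b := by
    intro k
    by_cases ho : G.owner (ω k) = b
    · exact Or.inl (hb k ho).1
    · refine (h.leave _ _ (hω k)).imp_right fun hne => ?_
      have h1 := howner (ω k)
      have h2 := stageWinner_eq (st (ω (k + 1)))
      omega
  have hinv : ∀ k, st (ω 0) ≤ st (ω k) ∨
      ∃ i ≤ k, st (ω i) ≤ st (ω k) ∧ stageWinner (st (ω i)) = b := by
    intro k
    induction k with
    | zero => exact Or.inl le_rfl
    | succ k ih =>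
      rcases hdec k with hk | hk
      · rcases ih with ih | ⟨i, hi, h1, h2⟩
        · exact Or.inl (ih.trans hk)
        · exact Or.inr ⟨i, by omega, h1.trans hk, h2⟩
      · exact Or.inr ⟨k + 1, le_rfl, le_rfl, hk⟩
  obtain ⟨k₀, hk₀⟩ : ∃ k₀, ∀ k, st (ω k₀) ≤ st (ω k) := by
    obtain ⟨_, ⟨k₀, rfl⟩, hmin⟩ := WellFounded.has_min (measure id).wf
      (Set.range fun k => st (ω k)) ⟨_, 0, rfl⟩
    exact ⟨k₀, fun k => not_lt.1 (hmin _ ⟨k, rfl⟩)⟩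
  have hwin : stageWinner (st (ω k₀)) = b := by
    rcases hinv k₀ with hk | ⟨i, -, h1, h2⟩
    · rw [le_antisymm (hk₀ 0) hk, h0]
    · rw [le_antisymm (hk₀ i) h1, h2]
  -- the least stage is attained at a state with the corresponding priority
  have hreach : ∀ N k, τ (ω k) < N → st (ω k) = st (ω k₀) →
      ∃ k', (p (ω k') : ℕ) + 1 = st (ω k₀) := by
    intro N
    induction N with
    | zero => intro k hk; omega
    | succ N ih =>
      intro k hk hst
      by_cases hp : (p (ω k) : ℕ) + 1 = st (ω k)
      · exact ⟨k, hp.trans hst⟩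
      · have hmin := hk₀ (k + 1)
        by_cases ho : G.owner (ω k) = b
        · obtain ⟨h1, h2⟩ := (hb k ho).2 hp (by rw [hst, hwin])
          exact ih (k + 1) (by omega) (by omega)
        · obtain ⟨h1, h2⟩ := h.forced _ hp (by rw [hst, hwin]; exact ho) _ (hω k)
          exact ih (k + 1) (by omega) (by omega)
  obtain ⟨k', hk'⟩ := hreach _ k₀ (Nat.lt_succ_self _) rfl
  have : minPriority p ω = p (ω k') := by
    refine le_antisymm (Nat.sInf_le ⟨ω k', ⟨k', rfl⟩, rfl⟩) (le_csInf ⟨_, ω k', ⟨k', rfl⟩, rfl⟩ ?_)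
    rintro _ ⟨_, ⟨k, rfl⟩, rfl⟩
    have h1 := h.le_prio (ω k)
    have h2 := hk₀ k
    dsimp only
    omega
  rw [this, hk', hwin]

theorem play_succ_of_mem {s : S} {σ : G.Strategy G.S₁} {π : G.Strategy G.S₂} {k : ℕ}
    (h : G.play s σ π k ∈ G.S₁) :
    ∃ w, G.play s σ π (k + 1) = σ.move w ⟨G.play s σ π k, h⟩ :=
  ⟨(G.outcome s σ π k).1, dif_pos h⟩

theorem play_succ_of_notMem {s : S} {σ : G.Strategy G.S₁} {π : G.Strategy G.S₂} {k : ℕ}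
    (h : G.play s σ π k ∉ G.S₁) :
    ∃ w, G.play s σ π (k + 1) = π.move w ⟨G.play s σ π k, h⟩ :=
  ⟨(G.outcome s σ π k).1, dif_neg h⟩

theorem play_mem_plays (s : S) (σ : G.Strategy G.S₁) (π : G.Strategy G.S₂) :
    G.play s σ π ∈ G.plays := by
  intro k
  by_cases h : G.play s σ π k ∈ G.S₁
  · obtain ⟨w, hw⟩ := play_succ_of_mem h
    rw [hw]
    exact σ.legal w ⟨_, h⟩
  · obtain ⟨w, hw⟩ := play_succ_of_notMem h
    rw [hw]
    exact π.legal w ⟨_, h⟩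

theorem JustifiedStages.mem_W₁ (h : G.JustifiedStages p st τ) {s : S}
    (hs : stageWinner (st s) = 1) : s ∈ G.W₁ (G.weakParityEven p) := by
  choose f hE hst hτ using h.exists_move
  refine ⟨⟨fun _ u => f u, fun _ u => hE u⟩, fun π => ⟨play_mem_plays _ _ _, ?_⟩⟩
  rw [← stageWinner_succ_eq_one]
  refine h.stageWinner_minPriority (play_mem_plays _ _ _) hs fun k hk => ?_
  obtain ⟨w, hw⟩ := play_succ_of_mem (k := k) (σ := ⟨fun _ u => f u, fun _ u => hE u⟩) (π := π)
    (s := s) (by by_contra hn; simp [owner, hn] at hk)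
  rw [hw]
  exact ⟨hst _, fun hp hb => hτ _ hp (hk.trans hb.symm)⟩

theorem JustifiedStages.mem_W₂ (h : G.JustifiedStages p st τ) {s : S}
    (hs : stageWinner (st s) = 2) : s ∈ G.W₂ (G.weakParityOdd p) := by
  choose f hE hst hτ using h.exists_move
  refine ⟨⟨fun _ u => f u, fun _ u => hE u⟩, fun σ => ⟨play_mem_plays _ _ _, ?_⟩⟩
  rw [← stageWinner_succ_eq_two]
  refine h.stageWinner_minPriority (play_mem_plays _ _ _) hs fun k hk => ?_
  obtain ⟨w, hw⟩ := play_succ_of_notMem (k := k) (π := ⟨fun _ u => f u, fun _ u => hE u⟩) (σ := σ)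
    (s := s) (by intro hn; simp [owner, hn] at hk)
  rw [hw]
  exact ⟨hst _, fun hp hb => hτ _ hp (hk.trans hb.symm)⟩

theorem disjoint_W₁_W₂ {s : S} (h₁ : s ∈ G.W₁ (G.weakParityEven p))
    (h₂ : s ∈ G.W₂ (G.weakParityOdd p)) : False := by
  obtain ⟨σ, hσ⟩ := h₁
  obtain ⟨π, hπ⟩ := h₂
  exact Nat.not_odd_iff_even.2 (hσ π).2 (hπ σ).2

theorem JustifiedStages.mem_W₁_iff (h : G.JustifiedStages p st τ) (s : S) :
    s ∈ G.W₁ (G.weakParityEven p) ↔ stageWinner (st s) = 1 :=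
  ⟨fun hs => (stageWinner_eq _).resolve_right fun h2 => disjoint_W₁_W₂ hs (h.mem_W₂ h2), h.mem_W₁⟩

theorem JustifiedStages.mem_W₂_iff (h : G.JustifiedStages p st τ) (s : S) :
    s ∈ G.W₂ (G.weakParityOdd p) ↔ stageWinner (st s) = 2 :=
  ⟨fun hs => (stageWinner_eq _).resolve_left fun h1 => disjoint_W₁_W₂ (h.mem_W₁ h1) hs, h.mem_W₂⟩

end GameGraph

/-! ### The program -/

namespace WeakParity

open Cmd ArrayGame

/-- Adds the edge number `index` to the list of edges with the same target, and counts it at its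
source. -/
def readEdge : Cmd :=
  add .x .index .index ;; add .x .x .edgeBase ;; get .u .x ;; add .x .x .one ;; get .v .x ;;
  load .count .y .u ;; add .y .y .one ;; store .count .u .y ;;
  load .head .y .v ;; store .next .index .y ;;
  add .index .index .one ;; store .head .v .index ;; sub .counter .counter .one

/-- Adds the state number `index` to the list of states with the same priority. -/
def readState : Cmd :=
  add .x .index .prioBase ;; get .v .x ;; load .seedHead .y .v ;; store .seedNext .index .y ;;
  add .index .index .one ;; store .seedHead .v .index ;; sub .counter .counter .one

/-- Gives the state `u` the current stage and puts it on the stack. -/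
def assign : Cmd :=
  store .stageOf .u .stage ;; store .stackNext .u .stack ;; add .stack .u .one

/-- Starts the next stage with the states of its priority as seeds. As the player numbers are `1` and
`2`, the winner changes from `player` to `3 - player`. -/
def nextStage : Cmd :=
  load .seedHead .seed .stage ;; add .stage .stage .one ;; const .x 3 ;; sub .player .x .player ;;
  store .playerOf .stage .player ;; add .go .d .one ;; sub .go .go .stage

/-- Takes the next state from the list of states of the current priority. -/
def takeSeed : Cmd :=
  sub .u .seed .one ;; load .seedNext .seed .u ;; load .stageOf .x .u ;;
  ifZero .x assign (const .x 0)

/-- Takes a state from the stack and begins to scan its incoming edges. -/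
def popState : Cmd :=
  sub .v .stack .one ;; load .stackNext .stack .v ;; load .head .edge .v

/-- Scans the edge `edge - 1`. The variable `z` becomes the minimum of the distance between the owner
of the source and the winner of the stage, and the number of other pending edges of the source. -/
def scanEdge : Cmd :=
  sub .y .edge .one ;; load .next .edge .y ;; add .y .y .y ;; add .y .y .edgeBase ;; get .u .y ;;
  load .stageOf .x .u ;;
  ifZero .x
    (load .count .x .u ;; sub .x .x .one ;; add .y .u .ownBase ;; get .y .y ;;
      sub .z .y .player ;; sub .y .player .y ;; add .z .z .y ;; sub .y .z .x ;; sub .z .z .y ;;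
      ifZero .z assign (store .count .u .x))
    (const .x 0)

/-- One pass of the main loop. It scans an edge if there is one to be scanned, and otherwise takes a
state from the stack, takes a seed, or starts the next stage, in this order of preference. -/
def mainStep : Cmd :=
  ifZero .edge (ifZero .stack (ifZero .seed nextStage takeSeed) popState) scanEdge

/-- Writes the output bits of the state number `index`. -/
def writeState : Cmd :=
  load .stageOf .x .index ;; load .playerOf .x .x ;; const .y 2 ;; sub .y .y .x ;; put .index .y ;;
  sub .x .x .one ;; add .z .index .n ;; put .z .x ;;
  add .index .index .one ;; sub .counter .counter .one

def readParameters : Cmd :=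
  const .x 0 ;; get .n .x ;; const .one 1 ;; get .m .one ;; const .x 2 ;; get .d .x ;;
  const .ownBase 3 ;; add .prioBase .ownBase .n ;; add .edgeBase .prioBase .n ;;
  const .index 0 ;; add .counter .m .index

/-- Prepares a loop over the states. -/
def rewind : Cmd := const .index 0 ;; add .counter .n .index

def startMain : Cmd :=
  const .stage 0 ;; const .player 2 ;; const .edge 0 ;; const .stack 0 ;; const .seed 0 ;;
  add .go .d .one

def solve : Cmd :=
  readParameters ;; .loop .counter readEdge ;; rewind ;; .loop .counter readState ;;
  startMain ;; .loop .go mainStep ;; rewind ;; .loop .counter writeState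

/-! ### Correctness and running time of the program -/

/-- The input `inp` describes the game `A`. -/
structure Encodes (A : ArrayGame) (inp : ℕ → ℕ) : Prop where
  n : inp 0 = A.n
  m : inp 1 = A.m
  d : inp 2 = A.d
  own : ∀ u < A.n, inp (3 + u) = A.own u
  pr : ∀ u < A.n, inp (3 + A.n + u) = A.pr u
  src : ∀ e < A.m, inp (3 + A.n + A.n + 2 * e) = A.src e
  tgt : ∀ e < A.m, inp (3 + A.n + A.n + 2 * e + 1) = A.tgt e

/-- The size of the input of the game `A`. -/
def inputSize (A : ArrayGame) : ℕ := 3 + 2 * A.n + 2 * A.m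

/-- The variables and the memory region that do not change after the parameters have been read. -/
structure Fixed (A : ArrayGame) (inp : ℕ → ℕ) (s : Store) : Prop where
  n : s.reg .n = A.n
  m : s.reg .m = A.m
  d : s.reg .d = A.d
  one : s.reg .one = 1
  ownBase : s.reg .ownBase = 3
  prioBase : s.reg .prioBase = 3 + A.n
  edgeBase : s.reg .edgeBase = 3 + A.n + A.n
  io : s.io = inp

variable {A : ArrayGame} {inp : ℕ → ℕ}

/-- The invariant of the loop that reads the edges. -/
structure ReadingEdges (A : ArrayGame) (inp : ℕ → ℕ) (N : ℕ) (s : Store) : Prop where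
  fixed : Fixed A inp s
  counter : s.reg .counter = N
  index : s.reg .index + N = A.m
  count : ∀ u, s.arr .count u =
    ((Finset.range (s.reg .index)).filter fun e => A.src e = u).card
  edges : Buckets (s.arr .head) (s.arr .next) A.tgt (s.reg .index)
  seedHead : s.arr .seedHead = fun _ => 0
  stageOf : s.arr .stageOf = fun _ => 0

/-- The invariant of the loop that reads the priorities. -/
structure ReadingStates (A : ArrayGame) (inp : ℕ → ℕ) (N : ℕ) (s : Store) : Prop where
  fixed : Fixed A inp s
  counter : s.reg .counter = N
  index : s.reg .index + N = A.n
  count : ∀ u, s.arr .count u = ((Finset.range A.m).filter fun e => A.src e = u).card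
  edges : Buckets (s.arr .head) (s.arr .next) A.tgt A.m
  states : Buckets (s.arr .seedHead) (s.arr .seedNext) A.pr (s.reg .index)
  stageOf : s.arr .stageOf = fun _ => 0

/-- The store `s` represents a state of the attractor computation. -/
structure Computing (A : ArrayGame) (inp : ℕ → ℕ) (τ : ℕ → ℕ) (cur stack q : List ℕ) (s : Store) :
    Prop where
  fixed : Fixed A inp s
  nil : s.reg .stage = 0 → cur = [] ∧ stack = []
  inv : A.Inv (s.arr .stageOf) (s.arr .count) τ (s.reg .stage) cur stack q
  cur : Chain (s.arr .next) (s.reg .edge) cur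
  stack : Chain (s.arr .stackNext) (s.reg .stack) stack
  seed : Chain (s.arr .seedNext) (s.reg .seed) q
  edges : Buckets (s.arr .head) (s.arr .next) A.tgt A.m
  states : Buckets (s.arr .seedHead) (s.arr .seedNext) A.pr A.n
  player : s.reg .player = stageWinner (s.reg .stage)
  go : s.reg .go = A.d + 1 - s.reg .stage
  playerOf : ∀ i ≤ s.reg .stage, i ≠ 0 → s.arr .playerOf i = stageWinner i

/-- The invariant of the main loop. -/
def MainInv (A : ArrayGame) (inp : ℕ → ℕ) (N : ℕ) (s : Store) : Prop :=
  ∃ τ cur stack q, Computing A inp τ cur stack q s ∧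
    A.potential (s.arr .stageOf) (s.reg .stage) cur stack q = N

/-- All states have a stage, and they are won by the winners of their stages. -/
structure Solved (A : ArrayGame) (st τ : ℕ → ℕ) : Prop where
  ne_zero : ∀ u < A.n, st u ≠ 0
  justified : ∀ u < A.n, A.Justified st τ u

/-- The invariant of the loop that writes the output. -/
structure Writing (A : ArrayGame) (st : ℕ → ℕ) (N : ℕ) (s : Store) : Prop where
  n : s.reg .n = A.n
  one : s.reg .one = 1
  counter : s.reg .counter = N
  index : s.reg .index + N = A.n
  stageOf : s.arr .stageOf = st
  playerOf : ∀ u < A.n, s.arr .playerOf (st u) = stageWinner (st u)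
  fst : ∀ i < s.reg .index, s.io i = 2 - stageWinner (st i)
  snd : ∀ i < s.reg .index, s.io (A.n + i) = stageWinner (st i) - 1

theorem readEdge_correct (hA : Encodes A inp) {N : ℕ} {s : Store} (h : ReadingEdges A inp N s)
    (hr : s.reg .counter ≠ 0) :
    readEdge.vc (inputSize A) (fun s' => ∃ N' < N, ReadingEdges A inp N' s') s := by
  obtain ⟨⟨hn, hm, hd, hone, hob, hpb, heb, hio⟩, hcounter, hindex, hcount, hedges, hsh, hst⟩ := h
  have hi : s.reg .index < A.m := by omega
  have e0 : s.reg .index + s.reg .index + (3 + A.n + A.n) = 3 + A.n + A.n + 2 * s.reg .index := by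
    omega
  simp [readEdge, vc, hone, heb, hio, e0, hA.src _ hi, hA.tgt _ hi]
  refine ⟨by unfold inputSize; omega, by unfold inputSize; omega, N - 1, by omega, ?_⟩
  constructor
  · constructor <;> simp [*]
  · simp [hcounter]
  · simp
    omega
  · intro u
    simp [Finset.range_add_one, Finset.filter_insert, Function.update_apply]
    split_ifs <;> simp_all
  · simpa using hedges.insert
  · simpa using hsh
  · simpa using hst

theorem readState_correct (hA : Encodes A inp) {N : ℕ} {s : Store} (h : ReadingStates A inp N s)
    (hr : s.reg .counter ≠ 0) :
    readState.vc (inputSize A) (fun s' => ∃ N' < N, ReadingStates A inp N' s') s := by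
  obtain ⟨⟨hn, hm, hd, hone, hob, hpb, heb, hio⟩, hcounter, hindex, hcount, hedges, hsh, hst⟩ := h
  have hi : s.reg .index < A.n := by omega
  have e0 : s.reg .index + (3 + A.n) = 3 + A.n + s.reg .index := by omega
  simp [readState, vc, hone, hpb, hio, e0, hA.pr _ hi]
  refine ⟨by unfold inputSize; omega, N - 1, by omega, ?_⟩
  constructor
  · constructor <;> simp [*]
  · simp [hcounter]
  · simp
    omega
  · simpa using hcount
  · simpa using hedges
  · simpa using hsh.insert
  · simpa using hst

theorem writeState_correct {st : ℕ → ℕ} {N : ℕ} {s : Store} (h : Writing A st N s)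
    (hr : s.reg .counter ≠ 0) :
    writeState.vc (inputSize A) (fun s' => ∃ N' < N, Writing A st N' s') s := by
  obtain ⟨hn, hone, hcounter, hindex, hst, hpl, h1, h2⟩ := h
  have hi : s.reg .index < A.n := by omega
  simp [writeState, vc, hone, hn, hst, hpl _ hi]
  refine ⟨by unfold inputSize; omega, by unfold inputSize; omega, N - 1, by omega, ?_⟩
  constructor
  · simp [hn]
  · simp [hone]
  · simp [hcounter]
  · simp
    omega
  · simpa using hst
  · simpa using hpl
  · intro i hi'
    simp at hi'
    simp [Function.update_apply]
    rw [if_neg (by omega)]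
    split_ifs with hii
    · rw [hii]
    · exact h1 i (by omega)
  · intro i hi'
    simp at hi'
    simp [Function.update_apply]
    split_ifs with hii h3
    · rw [show i = s.reg .index by omega]
    · omega
    · exact h2 i (by omega)

theorem nextStage_correct {L : ℕ} {τ : ℕ → ℕ} {s : Store} (h : Computing A inp τ [] [] [] s)
    (hgo : s.reg .go ≠ 0) :
    nextStage.vc L (fun s' => ∃ N' < A.potential (s.arr .stageOf) (s.reg .stage) [] [] [],
      MainInv A inp N' s') s := by
  obtain ⟨⟨hn, hm, hd, hone, hob, hpb, heb, hio⟩, hnil, hinv, hcur, hstack, hseed, hedges, hstates,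
    hplayer, hg, hpl⟩ := h
  simp [nextStage, vc, hone, hd]
  refine ⟨_, potential_next_stage (by omega), τ, [], [], bucket A.pr A.n (s.reg .stage), ?_, by simp⟩
  have hw : 3 - s.reg .player = stageWinner (s.reg .stage + 1) := by
    rw [hplayer]; unfold stageWinner; omega
  constructor
  · constructor <;> simp [*]
  · simp
  · simpa using hinv.next_stage
  · simpa using hcur
  · simpa using hstack
  · simpa using hstates (s.reg .stage)
  · simpa using hedges
  · simpa using hstates
  · simpa using hw
  · simp
  · intro i hi hi0
    simp at hi
    simp [Function.update_apply, hw]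
    split_ifs with hii
    · rw [hii]
    · exact hpl i (by omega) hi0

theorem takeSeed_correct {L : ℕ} {τ : ℕ → ℕ} {q : List ℕ} {s : Store}
    (h : Computing A inp τ [] [] q s) (hq : s.reg .seed ≠ 0) :
    takeSeed.vc L (fun s' => ∃ N' < A.potential (s.arr .stageOf) (s.reg .stage) [] [] q,
      MainInv A inp N' s') s := by
  obtain ⟨⟨hn, hm, hd, hone, hob, hpb, heb, hio⟩, hnil, hinv, hcur, hstack, hseed, hedges, hstates,
    hplayer, hg, hpl⟩ := h
  obtain ⟨q', rfl, hseed'⟩ := hseed.eq_cons hq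
  have hv := hinv.q_spec _ (List.mem_cons_self ..)
  have hj : s.reg .stage ≠ 0 := by omega
  simp [takeSeed, assign, vc, hone]
  constructor
  · intro hx
    obtain ⟨τ', hinv'⟩ := hinv.assign hv.1 hx hj (Or.inl hv.2)
    have hd' := hinv'.drop_seed (by simp [hj])
    refine ⟨_, potential_drop_seed.trans_eq (potential_assign hx), τ', [], [s.reg .seed - 1], q', ?_, by simp⟩
    constructor
    · constructor <;> simp [*]
    · simp [hj]
    · simpa using hd'
    · simpa using hcur
    · simpa using hstack.push (List.not_mem_nil)
    · simpa using hseed'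
    · simpa using hedges
    · simpa using hstates
    · simpa using hplayer
    · simpa using hg
    · simpa using hpl
  · intro hx
    refine ⟨_, potential_drop_seed, τ, [], [], q', ?_, by simp⟩
    constructor
    · constructor <;> simp [*]
    · simp
    · simpa using hinv.drop_seed hx
    · simpa using hcur
    · simpa using hstack
    · simpa using hseed'
    · simpa using hedges
    · simpa using hstates
    · simpa using hplayer
    · simpa using hg
    · simpa using hpl

theorem popState_correct {L : ℕ} {τ : ℕ → ℕ} {stack q : List ℕ} {s : Store}
    (h : Computing A inp τ [] stack q s) (hs : s.reg .stack ≠ 0) :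
    popState.vc L (fun s' => ∃ N' < A.potential (s.arr .stageOf) (s.reg .stage) [] stack q,
      MainInv A inp N' s') s := by
  obtain ⟨⟨hn, hm, hd, hone, hob, hpb, heb, hio⟩, hnil, hinv, hcur, hstack, hseed, hedges, hstates,
    hplayer, hg, hpl⟩ := h
  obtain ⟨l, rfl, hstack'⟩ := hstack.eq_cons hs
  have hj : s.reg .stage ≠ 0 := fun h0 => by simpa using (hnil h0).2
  simp [popState, vc, hone]
  refine ⟨_, hinv.potential_pop hj, τ, bucket A.tgt A.m (s.reg .stack - 1), l, q, ?_, by simp⟩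
  constructor
  · constructor <;> simp [*]
  · simp [hj]
  · simpa using hinv.pop
  · simpa using hedges _
  · simpa using hstack'
  · simpa using hseed
  · simpa using hedges
  · simpa using hstates
  · simpa using hplayer
  · simpa using hg
  · simpa using hpl

theorem scanEdge_correct (hA : Encodes A inp) {τ : ℕ → ℕ} {cur stack q : List ℕ} {s : Store}
    (h : Computing A inp τ cur stack q s) (hs : s.reg .edge ≠ 0) :
    scanEdge.vc (inputSize A) (fun s' => ∃ N' < A.potential (s.arr .stageOf) (s.reg .stage) cur stack q,
      MainInv A inp N' s') s := by
  obtain ⟨⟨hn, hm, hd, hone, hob, hpb, heb, hio⟩, hnil, hinv, hcur, hstack, hseed, hedges, hstates,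
    hplayer, hg, hpl⟩ := h
  obtain ⟨l, rfl, hcur'⟩ := hcur.eq_cons hs
  have hj : s.reg .stage ≠ 0 := fun h0 => by simpa using (hnil h0).1
  obtain ⟨he, htgt, -⟩ := hinv.cur_spec _ (List.mem_cons_self ..)
  generalize hed : s.reg .edge - 1 = e at *
  have e0 : e + e + (3 + A.n + A.n) = 3 + A.n + A.n + 2 * e := by omega
  have hu := A.src_lt e he
  have e1 : A.src e + 3 = 3 + A.src e := by omega
  have hlt := hinv.potential_edge hj
  simp [scanEdge, assign, vc, hone, hed, heb, e0, hio, hA.src e he, hob, e1, hA.own _ hu, hplayer]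
  refine ⟨by unfold inputSize; omega, fun hx => ⟨by unfold inputSize; omega, fun hz => ?_, fun hz => ?_⟩,
    fun hx => ?_⟩
  · have hreason : A.own (A.src e) = stageWinner (s.reg .stage) ∨
        (A.own (A.src e) ≠ stageWinner (s.reg .stage) ∧ s.arr .count (A.src e) - 1 = 0) := by
      omega
    obtain ⟨τ', hinv'⟩ := hinv.assign hu hx hj (Or.inr (hreason.imp
      (fun ho => ⟨ho, e, he, rfl, htgt⟩)
      (fun ho => ⟨ho.1, hinv.all_reached hj hx ho.2⟩)))
    have hd' := hinv'.skip_edge hj (by simp [hj])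
    refine ⟨_, ?_, τ', l, A.src e :: stack, q, ?_, rfl⟩
    · simpa [potential_assign hx] using hlt
    constructor
    · constructor <;> simp [*]
    · simp [hj]
    · simpa using hd'
    · simpa using hcur'
    · simpa using hstack.push fun hm => hj (by rw [← (hinv.stack_spec _ hm).2, hx])
    · simpa using hseed
    · simpa using hedges
    · simpa using hstates
    · simpa using hplayer
    · simpa using hg
    · simpa using hpl
  · have ho : A.own (A.src e) ≠ stageWinner (s.reg .stage) := by omega
    have hc : s.arr .count (A.src e) - 1 ≠ 0 := by omega
    refine ⟨_, hlt, τ, l, stack, q, ?_, by simp⟩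
    constructor
    · constructor <;> simp [*]
    · simp [hj]
    · simpa using hinv.count_edge hj ho hc
    · simpa using hcur'
    · simpa using hstack
    · simpa using hseed
    · simpa using hedges
    · simpa using hstates
    · simpa using hplayer
    · simpa using hg
    · simpa using hpl
  · refine ⟨_, hlt, τ, l, stack, q, ?_, by simp⟩
    constructor
    · constructor <;> simp [*]
    · simp [hj]
    · simpa using hinv.skip_edge hj hx
    · simpa using hcur'
    · simpa using hstack
    · simpa using hseed
    · simpa using hedges
    · simpa using hstates
    · simpa using hplayer
    · simpa using hg
    · simpa using hpl

theorem mainStep_correct (hA : Encodes A inp) {N : ℕ} {s : Store} (h : MainInv A inp N s)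
    (hgo : s.reg .go ≠ 0) :
    mainStep.vc (inputSize A) (fun s' => ∃ N' < N, MainInv A inp N' s') s := by
  obtain ⟨τ, cur, stack, q, hs, rfl⟩ := h
  refine ⟨fun he => ⟨fun hst => ⟨fun hq => ?_, fun hq => ?_⟩, fun hst => ?_⟩, fun he => ?_⟩
  · obtain rfl := hs.cur.eq_nil he
    obtain rfl := hs.stack.eq_nil hst
    obtain rfl := hs.seed.eq_nil hq
    exact nextStage_correct hs hgo
  · obtain rfl := hs.cur.eq_nil he
    obtain rfl := hs.stack.eq_nil hst
    exact takeSeed_correct hs hq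
  · obtain rfl := hs.cur.eq_nil he
    exact popState_correct hs hst
  · exact scanEdge_correct hA hs he

theorem Computing.solved {τ : ℕ → ℕ} {cur stack q : List ℕ} {s : Store}
    (h : Computing A inp τ cur stack q s) (hgo : s.reg .go = 0) : Solved A (s.arr .stageOf) τ := by
  have hne : ∀ u < A.n, s.arr .stageOf u ≠ 0 := fun u hu h0 => by
    have h1 := h.inv.j_le u hu h0
    have h2 := h.go
    have h3 := A.pr_lt u hu
    omega
  exact ⟨hne, fun u hu => h.inv.justified u hu (hne u hu)⟩

/-- What the program leaves in the memory: the winners of the stages of a solution. -/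
def Output (A : ArrayGame) (s : Store) : Prop :=
  ∃ st τ, Solved A st τ ∧ ∀ i < A.n,
    s.io i = 2 - stageWinner (st i) ∧ s.io (A.n + i) = stageWinner (st i) - 1

/-- The initial store. -/
def start (inp : ℕ → ℕ) : Store := ⟨fun _ => 0, inp, fun _ _ => 0⟩

/-- A bound on the running time of the program. -/
def time (A : ArrayGame) : ℕ :=
  readParameters.cost + (((readEdge.cost + 2) * A.m + 1) + (rewind.cost +
    (((readState.cost + 2) * A.n + 1) + (startMain.cost +
      (((mainStep.cost + 2) * (A.m + 2 * A.n + A.d + 1) + 1) + (rewind.cost +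
        ((writeState.cost + 2) * A.n + 1)))))))

theorem solve_correct (hA : Encodes A inp) :
    Runs (inputSize A) solve (start inp) (time A) (Output A) := by
  have h0 : (0 : ℕ) < inputSize A ∧ 1 < inputSize A ∧ 2 < inputSize A := by unfold inputSize; omega
  refine Runs.seq (Q := ReadingEdges A inp A.m) (runs_of_vc _ ?_) fun s hs => ?_
  · simp [readParameters, vc, start, h0]
    constructor
    · constructor <;> simp [hA.n, hA.m, hA.d]
    · simp [hA.m]
    · simp
    · simp
    · simpa using buckets_zero _ _
    · rfl
    · rfl
  refine Runs.seq (Runs.loop (ReadingEdges A inp) (fun N s h hr => runs_of_vc _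
    (readEdge_correct hA h hr)) hs) ?_
  rintro s ⟨hr, N, hs⟩
  refine Runs.seq (Q := ReadingStates A inp A.n) (runs_of_vc _ ?_) fun s hs => ?_
  · obtain ⟨⟨hn, hm, hd, hone, hob, hpb, heb, hio⟩, hcounter, hindex, hcount, hedges, hsh, hst⟩ := hs
    have hi : s.reg .index = A.m := by omega
    rw [hi] at hcount hedges
    simp [rewind, vc]
    constructor
    · constructor <;> simp [*]
    · simp [hn]
    · simp
    · simpa using hcount
    · simpa using hedges
    · simpa [hsh] using buckets_zero _ _
    · simpa using hst
  refine Runs.seq (Runs.loop (ReadingStates A inp) (fun N s h hr => runs_of_vc _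
    (readState_correct hA h hr)) hs) ?_
  rintro s ⟨hr, N, hs⟩
  refine Runs.seq (Q := fun s => ∃ N ≤ A.m + 2 * A.n + A.d + 1, MainInv A inp N s)
    (runs_of_vc _ ?_) ?_
  · obtain ⟨⟨hn, hm, hd, hone, hob, hpb, heb, hio⟩, hcounter, hindex, hcount, hedges, hstates, hst⟩ := hs
    have hi : s.reg .index = A.n := by omega
    rw [hi] at hstates
    simp [startMain, vc]
    refine ⟨_, potential_le A (fun _ => 0) [], fun _ => 0, [], [], [], ?_, by simp [hst]⟩
    constructor
    · constructor <;> simp [*]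
    · simp
    · simpa [hst] using Inv.initial hcount
    · simp [Chain]
    · simp [Chain]
    · simp [Chain]
    · simpa using hedges
    · simpa using hstates
    · simp [stageWinner]
    · simp [hd, hone]
    · simp
  rintro s ⟨N, hN, hs⟩
  refine Runs.seq ((Runs.loop (MainInv A inp) (fun N s h hr => runs_of_vc _
    (mainStep_correct hA h hr)) hs).mono (T' := (mainStep.cost + 2) * (A.m + 2 * A.n + A.d + 1) + 1)
      (Nat.add_le_add_right (Nat.mul_le_mul_left _ hN) 1) fun _ => id) ?_
  rintro s ⟨hgo, N, τ, cur, stack, q, hs, -⟩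
  have hsol := hs.solved hgo
  have hpl : ∀ u < A.n, s.arr .playerOf (s.arr .stageOf u) = stageWinner (s.arr .stageOf u) :=
    fun u hu => hs.playerOf _ (hs.inv.st_le u hu) (hsol.ne_zero u hu)
  have hfix := hs.fixed
  refine Runs.seq (Q := Writing A (s.arr .stageOf) A.n) (runs_of_vc _ ?_) fun s' hs' => ?_
  · simp [rewind, vc]
    constructor
    · simp [hfix.n]
    · simp [hfix.one]
    · simp [hfix.n]
    · simp
    · simp
    · simpa using hpl
    · simp
    · simp
  refine (Runs.loop (Writing A (s.arr .stageOf)) (fun N s h hr => runs_of_vc _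
    (writeState_correct h hr)) hs').mono le_rfl ?_
  rintro s'' ⟨hr, N, hs''⟩
  have hi : s''.reg .index = A.n := by
    have h1 := hs''.counter
    have h2 := hs''.index
    omega
  exact ⟨_, τ, hsol, fun i hi' => ⟨hs''.fst i (by omega), hs''.snd i (by omega)⟩⟩

end WeakParity

/-! ### The game given by the input -/

namespace GameGraph

variable {S : Type*} {G : GameGraph S} {d : ℕ} {p : S → Fin d}

theorem ownerArray_length {n : ℕ} (ν : S ≃ Fin n) : (G.ownerArray ν).length = n := by
  simp [ownerArray]

theorem priorityArray_length {n : ℕ} (ν : S ≃ Fin n) : (priorityArray ν p).length = n := by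
  simp [priorityArray]

theorem edgeArray_length {n : ℕ} (ν : S ≃ Fin n) (l : List (S × S)) :
    (edgeArray ν l).length = 2 * l.length := by
  induction l with
  | nil => rfl
  | cons e l ih =>
    simp only [edgeArray, List.flatMap_cons, List.length_append, List.length_cons] at ih ⊢
    rw [ih, List.length_nil]
    omega

theorem edgeArray_getD {n : ℕ} (ν : S ≃ Fin n) (l : List (S × S)) {e : ℕ} (he : e < l.length) :
    (edgeArray ν l).getD (2 * e) 0 = ν l[e].1 ∧ (edgeArray ν l).getD (2 * e + 1) 0 = ν l[e].2 := by
  induction l generalizing e with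
  | nil => simp at he
  | cons a l ih =>
    cases e with
    | zero => simp [edgeArray]
    | succ e =>
      exact ih (e := e) (by simpa using he)

variable [Fintype S]

variable (G) (p)
  (ν : S ≃ Fin (Fintype.card S)) (edges : List (S × S))

/-- The game on the numbers of the states and of the edges. Outside the range of these numbers the
values are irrelevant. -/
noncomputable def toArrayGame (hE : ∀ e : S × S, e ∈ edges ↔ e ∈ G.E) : ArrayGame where
  n := Fintype.card S
  m := edges.length
  d := d
  src e := if h : e < edges.length then ν edges[e].1 else 0
  tgt e := if h : e < edges.length then ν edges[e].2 else 0
  own u := if h : u < Fintype.card S then G.owner (ν.symm ⟨u, h⟩) else 0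
  pr u := if h : u < Fintype.card S then p (ν.symm ⟨u, h⟩) else 0
  src_lt e he := by simp [he]
  tgt_lt e he := by simp [he]
  pr_lt u hu := by simp [hu]
  exists_edge u hu := by
    obtain ⟨t, ht⟩ := G.exists_succ (ν.symm ⟨u, hu⟩)
    obtain ⟨e, he, heq⟩ := List.mem_iff_getElem.1 ((hE _).2 ht)
    exact ⟨e, he, by simp [he, heq]⟩

variable {edges} {p} {ν} {G}

theorem gameInput_length : (gameInput G p ν edges).length =
    3 + 2 * Fintype.card S + 2 * edges.length := by
  simp only [gameInput, List.length_append, ownerArray_length, priorityArray_length,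
    edgeArray_length, List.length_cons, List.length_nil]
  omega

theorem encodes_gameInput (hE : ∀ e : S × S, e ∈ edges ↔ e ∈ G.E) :
    WeakParity.Encodes (G.toArrayGame p ν edges hE) fun i => (gameInput G p ν edges).getD i 0 where
  n := by simp [gameInput, toArrayGame]
  m := by simp [gameInput, toArrayGame]
  d := by simp [gameInput, toArrayGame]
  own u hu := by
    change u < Fintype.card S at hu
    simp only [gameInput, List.append_assoc]
    rw [List.getD_append_right _ _ _ _ (by simp), List.getD_append _ _ _ _ (by simpa [ownerArray_length])]
    simp [ownerArray, toArrayGame, hu, owner]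
    classical
    exact if_congr (by rw [List.getElem_finRange]; rfl) rfl rfl
  pr u hu := by
    change u < Fintype.card S at hu
    change List.getD _ (3 + Fintype.card S + u) 0 = _
    simp only [gameInput, List.append_assoc]
    rw [List.getD_append_right _ _ _ _ (by simp; omega),
      List.getD_append_right _ _ _ _ (by simp [ownerArray_length]; omega),
      List.getD_append _ _ _ _ (by simp [ownerArray_length, priorityArray_length]; omega),
      show 3 + Fintype.card S + u - [Fintype.card S, edges.length, d].length -
        (G.ownerArray ν).length = u by simp [ownerArray_length]; omega]
    simp [priorityArray, toArrayGame, hu]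
  src e he := by
    change e < edges.length at he
    change List.getD _ (3 + Fintype.card S + Fintype.card S + 2 * e) 0 = _
    rw [gameInput, List.getD_append_right _ _ _ _
        (by simp [ownerArray_length, priorityArray_length]; omega),
      show 3 + Fintype.card S + Fintype.card S + 2 * e - ([Fintype.card S, edges.length, d] ++
        G.ownerArray ν ++ priorityArray ν p).length = 2 * e by
          simp [ownerArray_length, priorityArray_length]; omega,
      (edgeArray_getD ν edges he).1]
    simp [toArrayGame, he]
  tgt e he := by
    change e < edges.length at he
    change List.getD _ (3 + Fintype.card S + Fintype.card S + 2 * e + 1) 0 = _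
    rw [gameInput, List.getD_append_right _ _ _ _
        (by simp [ownerArray_length, priorityArray_length]; omega),
      show 3 + Fintype.card S + Fintype.card S + 2 * e + 1 - ([Fintype.card S, edges.length, d] ++
        G.ownerArray ν ++ priorityArray ν p).length = 2 * e + 1 by
          simp [ownerArray_length, priorityArray_length]; omega,
      (edgeArray_getD ν edges he).2]
    simp [toArrayGame, he]

theorem toArrayGame_edge (hE : ∀ e : S × S, e ∈ edges ↔ e ∈ G.E) {e : ℕ}
    (he : e < edges.length) {s : S} (hs : (G.toArrayGame p ν edges hE).src e = ν s) :
    ∃ t, (s, t) ∈ G.E ∧ (G.toArrayGame p ν edges hE).tgt e = ν t := by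
  simp only [toArrayGame, he, dif_pos] at hs ⊢
  have : edges[e].1 = s := ν.injective (Fin.ext hs)
  subst this
  exact ⟨edges[e].2, (hE _).1 (List.getElem_mem he), rfl⟩

theorem exists_toArrayGame_edge (hE : ∀ e : S × S, e ∈ edges ↔ e ∈ G.E) {s t : S}
    (h : (s, t) ∈ G.E) : ∃ e < edges.length, (G.toArrayGame p ν edges hE).src e = ν s ∧
      (G.toArrayGame p ν edges hE).tgt e = ν t := by
  obtain ⟨e, he, heq⟩ := List.mem_iff_getElem.1 ((hE _).2 h)
  exact ⟨e, he, by simp [toArrayGame, he, heq]⟩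

theorem justifiedStages_of_solved (hE : ∀ e : S × S, e ∈ edges ↔ e ∈ G.E) {st τ : ℕ → ℕ}
    (h : WeakParity.Solved (G.toArrayGame p ν edges hE) st τ) :
    G.JustifiedStages p (fun s => st (ν s)) (fun s => τ (ν s)) := by
  have hpr : ∀ s, (G.toArrayGame p ν edges hE).pr (ν s) = p s := fun s => by simp [toArrayGame]
  have hown : ∀ s, (G.toArrayGame p ν edges hE).own (ν s) = G.owner s := fun s => by
    simp [toArrayGame]
  have hJ := fun s : S => h.justified (ν s) (ν s).2
  have hne := fun s : S => h.ne_zero (ν s) (ν s).2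
  constructor
  · exact hne
  · intro s
    rw [← hpr]
    exact (hJ s).le_prio
  · intro s
    obtain ⟨e, he, hsrc, ht⟩ := (hJ s).stay
    obtain ⟨t, hst, hte⟩ := toArrayGame_edge hE he hsrc
    rw [hte] at ht
    exact ⟨t, hst, ht.resolve_left (hne t)⟩
  · intro s t hst
    obtain ⟨e, he, hsrc, hte⟩ := exists_toArrayGame_edge (p := p) (ν := ν) hE hst
    have := (hJ s).leave e he hsrc
    rw [hte, hown] at this
    exact this.resolve_left (hne t)
  · intro s hp ho
    obtain ⟨e, he, hsrc, ht⟩ := (hJ s).attract (by rwa [hpr]) (by rwa [hown])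
    obtain ⟨t, hst, hte⟩ := toArrayGame_edge hE he hsrc
    rw [hte] at ht
    exact ⟨t, hst, ht⟩
  · intro s hp ho t hst
    obtain ⟨e, he, hsrc, hte⟩ := exists_toArrayGame_edge (p := p) (ν := ν) hE hst
    have := ((hJ s).forced (by rwa [hpr]) (by rwa [hown]) e he hsrc).2
    rwa [hte] at this

end GameGraph

namespace WeakParity

open Cmd RAM

/-- Puts the size of the input into register `0`. -/
def measureInput : Program :=
  [.const 1 0, .load 0 1, .const 1 1, .load 1 1, .add 0 0 1, .add 0 0 0, .const 1 3, .add 0 0 1]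

/-- The machine program. The code of `solve` starts at the address `8`. -/
def program : Program := measureInput ++ solve.code 8

theorem measureInput_run {A : ArrayGame} {x : List ℕ} (hx : x.length = inputSize A)
    (hA : Encodes A fun i => x.getD i 0) : ∃ C, (step program)^[8] (init x) = C ∧ C.pc = 8 ∧
      Represents (inputSize A) C (start fun i => x.getD i 0) := by
  refine ⟨_, rfl, ?_⟩
  have e : (step program)^[8] (init x) =
      ⟨8, Function.update (Function.update (fun _ => 0) 0 (inputSize A)) 1 3,
        fun i => x.getD i 0⟩ := by
    rw [iterate_step (I := .const 1 0) rfl, iterate_step (I := .load 0 1) rfl,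
      iterate_step (I := .const 1 1) rfl, iterate_step (I := .load 1 1) rfl,
      iterate_step (I := .add 0 0 1) rfl, iterate_step (I := .add 0 0 0) rfl,
      iterate_step (I := .const 1 3) rfl, iterate_step (I := .add 0 0 1) rfl]
    have h0 := hA.n
    have h1 := hA.m
    simp only [Function.iterate_zero, id, Instr.exec, init, Config.mk.injEq, and_true, true_and]
    funext r
    simp only [Function.update_apply]
    have : inputSize A = A.n + A.m + (A.n + A.m) + 3 := by unfold inputSize; omega
    split_ifs <;> simp_all
  rw [e]
  refine ⟨rfl, by simp, fun r => ?_, fun _ _ => rfl, fun B i => ?_⟩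
  · have := vr_ne r
    simp [this, start]
  · exact List.getD_eq_default _ _ (by omega)

theorem program_correct {A : ArrayGame} {x : List ℕ} (hx : x.length = inputSize A)
    (hA : Encodes A fun i => x.getD i 0) : ∃ k ≤ time A + 8,
      program.length ≤ ((step program)^[k] (init x)).pc ∧ ∃ st τ, Solved A st τ ∧ ∀ i < A.n,
        ((step program)^[k] (init x)).mem i = 2 - stageWinner (st i) ∧
        ((step program)^[k] (init x)).mem (A.n + i) = stageWinner (st i) - 1 := by
  obtain ⟨C, hC, hpc, hR⟩ := measureInput_run hx hA
  obtain ⟨t, ht, s, ⟨st, τ, hsol, hs⟩, hRs, hpc'⟩ := solve_correct hA program C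
    (by rw [hpc]; exact placed_of_append measureInput _) hR
  rw [← hC, ← Function.iterate_add_apply] at hRs hpc'
  refine ⟨t + 8, by omega, ?_, st, τ, hsol, fun i hi => ?_⟩
  · rw [hpc', hC, hpc, program, List.length_append, show measureInput.length = 8 from rfl]
  · rw [hRs.io i (by unfold inputSize; omega), hRs.io (A.n + i) (by unfold inputSize; omega)]
    exact hs i hi

/-- The running time is linear in the number of edges if the number of priorities is linear in the
number of states. -/
theorem exists_time_le (K : ℕ) : ∃ c, ∀ A : ArrayGame, 1 ≤ A.n → A.n ≤ A.m → A.d ≤ K * A.n →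
    time A + 8 ≤ c * A.m := by
  refine ⟨readParameters.cost + (((readEdge.cost + 2) + 1) + (rewind.cost +
    (((readState.cost + 2) + 1) + (startMain.cost +
      (((mainStep.cost + 2) * (K + 4) + 1) + (rewind.cost +
        ((writeState.cost + 2) + 1))))))) + 8, fun A h1 hnm hd => ?_⟩
  have hone : 1 ≤ A.m := h1.trans hnm
  have hsum : A.m + 2 * A.n + A.d + 1 ≤ (K + 4) * A.m := by
    have : K * A.n ≤ K * A.m := Nat.mul_le_mul_left _ hnm
    rw [add_mul]
    omega
  have hlin : ∀ a, a ≤ a * A.m := fun a => Nat.le_mul_of_pos_right a hone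
  have hloop : ∀ a N k, N ≤ k * A.m → a * N + 1 ≤ (a * k + 1) * A.m := fun a N k hN => by
    rw [add_mul, one_mul, mul_assoc]
    exact Nat.add_le_add (Nat.mul_le_mul_left _ hN) hone
  have hn1 : A.n ≤ 1 * A.m := by omega
  have hm1 : A.m ≤ 1 * A.m := by omega
  have h2 := hloop (readEdge.cost + 2) _ _ hm1
  have h3 := hloop (readState.cost + 2) _ _ hn1
  have h4 := hloop (mainStep.cost + 2) _ _ hsum
  have h5 := hloop (writeState.cost + 2) _ _ hn1
  rw [mul_one] at h2 h3 h5
  simp only [add_mul _ _ A.m, time] at h2 h3 h4 h5 ⊢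
  have := hlin readParameters.cost
  have := hlin rewind.cost
  have := hlin startMain.cost
  omega

end WeakParity

/-- One program for a random access machine computes, for every game graph `G` and every priority
function `p : S → [d]`, the winning sets of both players, and for every `K` it does so in `O(m)` time
on the games with `d ≤ K * n`. The states are numbered and the edges are listed in an arbitrary way. -/
theorem theorem2 :
    ∃ P : RAM.Program, ∀ K : ℕ, ∃ c : ℕ,
      ∀ (S : Type*) [Fintype S] [Nonempty S] (G : GameGraph S) (d : ℕ) (p : S → Fin d)
        (ν : S ≃ Fin (Fintype.card S)) (edges : List (S × S)),
        edges.Nodup → (∀ e : S × S, e ∈ edges ↔ e ∈ G.E) →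
        d ≤ K * Fintype.card S →
        RAM.ComputesWithin P (gameInput G p ν edges)
          (setArray ν (G.W₁ (G.weakParityEven p)) ++ setArray ν (G.W₂ (G.weakParityOdd p)))
          (c * G.E.ncard) := by

  refine ⟨WeakParity.program, fun K => ?_⟩
  obtain ⟨c, hc⟩ := WeakParity.exists_time_le K
  refine ⟨c, fun S _ _ G d p ν edges hnd hE hd => ?_⟩
  classical
  have hcard : G.E.ncard = edges.length := by
    rw [← List.toFinset_card_of_nodup hnd, ← Set.ncard_coe_finset]
    congr 1
    ext e
    simp [hE]
  have hnm : Fintype.card S ≤ edges.length := by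
    choose f hf using G.exists_succ
    rw [← List.toFinset_card_of_nodup hnd, ← Finset.card_univ]
    refine Finset.card_le_card_of_injOn (fun s => (s, f s)) (fun s _ => ?_)
      fun s _ t _ h => (Prod.ext_iff.1 h).1
    simpa [hE] using hf s
  have hA := G.encodes_gameInput (p := p) (ν := ν) hE
  obtain ⟨k, hk, hhalt, st, τ, hsol, hout⟩ :=
    WeakParity.program_correct GameGraph.gameInput_length hA
  have hJ := GameGraph.justifiedStages_of_solved hE hsol
  refine ⟨k, hk.trans ?_, hhalt, fun i hi => ?_⟩
  · rw [hcard]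
    exact hc _ Fintype.card_pos hnm hd
  have hlen : ∀ W : Set S, (setArray ν W).length = Fintype.card S := fun W => by simp [setArray]
  rw [List.length_append, hlen, hlen] at hi
  by_cases hi' : i < Fintype.card S
  · rw [(hout i hi').1, List.getElem_append_left (by rwa [hlen])]
    simp only [setArray, List.getElem_map, List.getElem_finRange, hJ.mem_W₁_iff,
      Equiv.apply_symm_apply, Fin.val_cast]
    have := stageWinner_eq (st i)
    split_ifs <;> omega
  · obtain ⟨i, rfl⟩ := Nat.exists_eq_add_of_le (not_lt.1 hi')
    have hi'' : i < Fintype.card S := by omega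
    have h2 := (hout i hi'').2
    change RAM.Config.mem _ (Fintype.card S + i) = _ at h2
    rw [h2, List.getElem_append_right (by simp [hlen])]
    simp only [setArray, List.getElem_map, List.getElem_finRange, hJ.mem_W₂_iff,
      Equiv.apply_symm_apply, Fin.val_cast, List.length_map, List.length_finRange,
      Nat.add_sub_cancel_left]
    have := stageWinner_eq (st i)
    split_ifs <;> omega
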